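/- **Setting.** A (homogeneous) halfspace on $\mathbb R^M$ is a function $f(x)=1$ if $\langle w,x\rangle\ge 0$ and $f(x)=-1$ otherwise, for some $w\in\mathbb R^M$. Let $A>0$ and $\alpha\in[0,1)$. A distribution $D$ on $\mathbb R^M\times\{-1,1\}$ belongs to the $(A,\alpha)$-Tsybakov noise model for halfspaces if there are a probability distribution $D_x$ on $\mathbb R^M$, a halfspace $f$ and a measurable $\eta:\mathbb R^M\to[0,1/2]$ such that $(x,y)\sim D$ is generated by drawing $x\sim D_x$ and setting $y=-f(x)$ with probability $\eta(x)$ and $y=f(x)$ with probability $1-\eta(x)$, and $$\Pr_{x\sim D_x}\big[\eta(x)\ge \tfrac12-t\big]\le A\,t^{\alpha/(1-\alpha)}\qquad\text{for all } 0<t\le \tfrac12 .$$ At $t=1/2$ this inequality says exactly that $A\ge 2^{\alpha/(1-\alpha)}$, so for smaller $A$ no distribution satisfies the condition; by the *relaxed* model we mean the one in which the condition is required only for $0<t<1/2$. Put $\mathrm{OPT}=\Pr_{(x,y)\sim D}[f(x)\ne y]$. An SQ algorithm is a (possibly randomized, computationally unbounded) algorithm that adaptively asks queries $q:\mathbb R^M\times\{-1,1\}\to[-1,1]$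 (measurable), receives for each query a value within $\tau$ (the accuracy) of $\mathbb E_{D}\,q(x,y)$, and outputs a measurable hypothesis $h:\mathbb R^M\to\{-1,1\}$. It learns a family of distributions to error better than $\varepsilon$ with $N$ queries of accuracy $\tau$ and success probability $p$ if, for every $D$ in the family and all answers of accuracy $\tau$, with probability at least $p$ it asks at most $N$ queries and $\Pr_{(x,y)\sim D}[h(x)\ne y]<\varepsilon$. **Theorem.** For every $\kappa>0$ there is a constant $C=C(\kappa)>0$ such that for all constants $A>0$, $c\in(0,1)$, $p>0$ and $K\in\mathbb N$ there is $M_0$ such that for all $M\ge M_0$ and all $\alpha\in[0,1-\kappa]$ the following holds. If $A\ge 2^{\alpha/(1-\alpha)}$, then no SQ algorithm using at most $M^K$ queries of accuracy $\tau\ge M^{-K}$ learns, with success probability $p$, the distributions of the $(A,\alpha)$-Tsybakov noise model for halfspaces on $\mathbb R^M$ with $\mathrm{OPT}=2^{-(\log M)^c}$ to misclassification error better than $$\tfrac12-\exp\!\big(-C(\log M)^c\big).$$ For arbitrary $A>0$ the same holds for the relaxed model. -/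

import Mathlib

open MeasureTheory

/-- Labels are the elements `1` and `-1` of `ℤˣ`; a hypothesis is a measurable classifier. -/
structure Hypothesis (X : Type) [MeasurableSpace X] where
  toFun : X → ℤˣ
  measurable : Measurable toFun

/-- A statistical query: a measurable function of an example and its label, with values in
`[-1, 1]`. -/
structure StatQuery (X : Type) [MeasurableSpace X] where
  toFun : X × ℤˣ → ℝ
  measurable : Measurable toFun
  abs_le_one : ∀ z, |toFun z| ≤ 1

/-- An adaptive (computationally unbounded) statistical query algorithm: a decision tree which
either stops with a hypothesis or asks a query and continues in a way depending on the answer. -/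
inductive SQAlgorithm (X : Type) [MeasurableSpace X] where
  | output (h : Hypothesis X) : SQAlgorithm X
  | query (q : StatQuery X) (next : ℝ → SQAlgorithm X) : SQAlgorithm X

namespace SQAlgorithm

variable {X : Type} [MeasurableSpace X]

/-- The hypothesis which is output when the queries are answered by `O`. -/
def result (O : StatQuery X → ℝ) : SQAlgorithm X → Hypothesis X
  | output h => h
  | query q next => result O (next (O q))

/-- The number of queries which are asked when the queries are answered by `O`. -/
def numQueries (O : StatQuery X → ℝ) : SQAlgorithm X → ℕ
  | output _ => 0
  | query q next => numQueries O (next (O q)) + 1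

end SQAlgorithm

/-- `O` answers all statistical queries about `D` correctly up to accuracy `τ`. -/
def IsStatOracle {X : Type} [MeasurableSpace X] (D : Measure (X × ℤˣ)) (τ : ℝ)
    (O : StatQuery X → ℝ) : Prop :=
  ∀ q : StatQuery X, |O q - ∫ z, q.toFun z ∂D| ≤ τ

/-- The misclassification error of `h` on `D`. -/
noncomputable def misclassificationError {X : Type} [MeasurableSpace X]
    (D : Measure (X × ℤˣ)) (h : X → ℤˣ) : ℝ :=
  D.real {z | h z.1 ≠ z.2}

/-- A randomized statistical query algorithm: a random seed selects an adaptive algorithm.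
Deterministic algorithms are the case of a one-point seed space. -/
structure RandomizedSQAlgorithm (X : Type) [MeasurableSpace X] where
  Seed : Type
  measurableSpace : MeasurableSpace Seed
  law : Measure Seed
  isProbabilityMeasure : IsProbabilityMeasure law
  alg : Seed → SQAlgorithm X

/-- `R` learns the family `𝒟` of distributions with at most `N` queries of accuracy `τ` to
misclassification error better than `ε`, with success probability at least `p`: for every `D` in
the family and all answers that are correct up to `τ`, with probability at least `p` over the seed
at most `N` queries are asked and the hypothesis which is output has error less than `ε`.
(The event of success is required to contain a measurable event of probability at least `p`.) -/
def RandomizedSQAlgorithm.Learns {X : Type} [MeasurableSpace X] (R : RandomizedSQAlgorithm X)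
    (𝒟 : Set (Measure (X × ℤˣ))) (N : ℕ) (τ ε p : ℝ) : Prop :=
  ∀ D ∈ 𝒟, ∀ O : StatQuery X → ℝ, IsStatOracle D τ O →
    ∃ G : Set R.Seed, MeasurableSet[R.measurableSpace] G ∧ ENNReal.ofReal p ≤ R.law G ∧
      ∀ s ∈ G, (R.alg s).numQueries O ≤ N ∧
        misclassificationError D ((R.alg s).result O).toFun < ε

/-- The (homogeneous) halfspace with normal vector `w`: it takes the value `1` where `⟪w, x⟫ ≥ 0`
and `-1` elsewhere. -/
noncomputable def halfspace {M : ℕ} (w : EuclideanSpace ℝ (Fin M)) :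
    EuclideanSpace ℝ (Fin M) → ℤˣ :=
  open Classical in fun x => if 0 ≤ inner ℝ w x then 1 else -1

/-- The law of `(x, y)` when `x ∼ Dx` and, given `x`, `y = f x` with probability `1 - η x` and
`y = - f x` with probability `η x`. -/
noncomputable def noisyLabels {X : Type} [MeasurableSpace X] (Dx : Measure X) (f : X → ℤˣ)
    (η : X → ℝ) : Measure (X × ℤˣ) :=
  (Dx.withDensity fun x => ENNReal.ofReal (1 - η x)).map (fun x => (x, f x)) +
    (Dx.withDensity fun x => ENNReal.ofReal (η x)).map (fun x => (x, -f x))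

/-- The `(A, α)`-Tsybakov condition on the flipping probabilities `η`, for `t` in the range `T`. -/
def TsybakovCondition {X : Type} [MeasurableSpace X] (T : Set ℝ) (A α : ℝ) (Dx : Measure X)
    (η : X → ℝ) : Prop :=
  ∀ t ∈ T, Dx.real {x | 1 / 2 - t ≤ η x} ≤ A * t ^ (α / (1 - α))

/-- The distributions of labelled examples in the `(A, α)`-Tsybakov noise model for halfspaces in
dimension `M` (with the Tsybakov condition for `t` in the range `T`) for which
`OPT`, the misclassification error of the true halfspace, equals `ζ`. -/
def tsybakovHalfspaces (M : ℕ) (T : Set ℝ) (A α ζ : ℝ) :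
    Set (Measure (EuclideanSpace ℝ (Fin M) × ℤˣ)) :=
  {D | ∃ (Dx : Measure (EuclideanSpace ℝ (Fin M))) (w : EuclideanSpace ℝ (Fin M))
      (η : EuclideanSpace ℝ (Fin M) → ℝ),
    IsProbabilityMeasure Dx ∧ Measurable η ∧ (∀ x, 0 ≤ η x ∧ η x ≤ 1 / 2) ∧
    TsybakovCondition T A α Dx η ∧
    D = noisyLabels Dx (halfspace w) η ∧
    misclassificationError D (halfspace w) = ζ}

/-! Examples are drawn from the cube of `m` pairs of integers in `[-v, v]`. A secret bit vector `b`
selects one integer from each pair, and the law depends on `b` only through the sum `z` of the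
selected integers. The slice with label `1` has density proportional to `1 + (-1)^z`, the slice with
label `-1` to `1 + (-1)^z (1 - 2 g(z))`, where the window `g` is `1` for `|z| ≤ k` and `0` for `|z|
> 2k`. For `|z| ≤ k` the label is thus the parity of `z`, without noise. For `|z| > 2k` only even
`z` carry mass, and label `1` is favoured with bias `t`. The label `-1` is optimal only at odd `z`
with `|z| ≤ 2k`, a polynomial threshold of degree `O(k)` and hence a halfspace in monomial features.
Noise needs `|z| > k`, which is rare by a Chernoff bound, and its rate never exceeds `1/2 - t`. This
gives the Tsybakov condition, and an additional atom adjusts OPT exactly.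

Queries reveal little because `g` is a `k`-fold mean of neighbouring values. Summing parity times
such a mean over one coordinate telescopes to boundary terms and gains a factor `1 / (2v + 1)`, so
secrets that differ in at least `k` places give almost uncorrelated perturbations
(`abs_correlation_le`). Most pairs of secrets are that far apart, so a second-moment argument
(`card_large_correlation_le`) shows that each query distinguishes few secrets from a reference in
which the labels on the cube are independent coins of bias `t`. An oracle may answer with the
reference whenever that is accurate. A hypothesis with small error is itself a distinguishing query,
so an algorithm succeeds for few secrets (`not_learns_of_card_le`).

With `m = J k`, the number of features is at most `b ^ k` for a base `b` polynomial in `J`, whereas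
the counting gains `(3/4) ^ (J k)`. A constant `J` therefore beats any `M ^ K`, and then `v` is a
constant too. Since `k` is of order `log M`, the tail is a negative power of `M`, below `2 ^ (-(log
M)^c)` because `c < 1`. -/

/-! ### From learning to counting distinguished distributions -/

/-- Along the single branch on which every answer is `Φ q`, each query loses at most `cnt` indices,
and the final hypothesis is good for at most `cnt` more. -/
lemma card_success_le {X : Type} [MeasurableSpace X] {β : Type} [Fintype β]
    (D : β → Measure (X × ℤˣ)) (Φ : StatQuery X → ℝ) (τ ε cnt : ℝ)
    (O : β → StatQuery X → ℝ)
    (hO : ∀ b q, |∫ z, q.toFun z ∂(D b) - Φ q| ≤ τ → O b q = Φ q)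
    (hq : ∀ q : StatQuery X, ({b | τ < |∫ z, q.toFun z ∂(D b) - Φ q|} : Set β).ncard ≤ cnt)
    (hh : ∀ h : Hypothesis X,
      ({b | misclassificationError (D b) h.toFun < ε} : Set β).ncard ≤ cnt)
    (T : SQAlgorithm X) : ∀ N : ℕ,
      ({b | T.numQueries (O b) ≤ N ∧
        misclassificationError (D b) (T.result (O b)).toFun < ε} : Set β).ncard
        ≤ (N + 1) * cnt := by
  have hcnt : 0 ≤ cnt := le_trans (by positivity) (hh ⟨fun _ => 1, measurable_const⟩)
  induction T with
  | output h =>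
    intro N
    refine le_trans ?_ ((hh h).trans (by nlinarith [Nat.cast_nonneg (α := ℝ) N]))
    exact Nat.cast_le.2 (Set.ncard_le_ncard (fun b hb => And.right hb) (Set.toFinite _))
  | query q next ih =>
    intro N
    rcases N with _ | N
    · have : ({b | (SQAlgorithm.query q next).numQueries (O b) ≤ 0 ∧
          misclassificationError (D b) ((SQAlgorithm.query q next).result (O b)).toFun < ε} :
          Set β) = ∅ := by
        ext b; simp [SQAlgorithm.numQueries]
      rw [this]; simpa using hcnt
    · have hsub : ({b | (SQAlgorithm.query q next).numQueries (O b) ≤ N + 1 ∧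
          misclassificationError (D b) ((SQAlgorithm.query q next).result (O b)).toFun < ε} :
          Set β) ⊆ {b | τ < |∫ z, q.toFun z ∂(D b) - Φ q|} ∪
            {b | (next (Φ q)).numQueries (O b) ≤ N ∧
              misclassificationError (D b) ((next (Φ q)).result (O b)).toFun < ε} := by
        rintro b ⟨h1, h2⟩
        by_cases hb : τ < |∫ z, q.toFun z ∂(D b) - Φ q|
        · exact Or.inl hb
        · have := hO b q (not_lt.1 hb)
          simp only [SQAlgorithm.numQueries, SQAlgorithm.result, this] at h1 h2
          exact Or.inr ⟨by omega, h2⟩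
      have h3 := (Set.ncard_le_ncard hsub (Set.toFinite _)).trans (Set.ncard_union_le _ _)
      have h4 : (_ : ℝ) ≤ _ := Nat.cast_le.2 h3
      refine h4.trans ?_
      have := ih (Φ q) N
      have := hq q
      push_cast
      linarith

/-- For each fixed seed few indices succeed, so averaging over the seed bounds the sum of the
success probabilities over all indices, which would have to be at least `p` times their number. -/
theorem not_learns_of_card_le {X : Type} [MeasurableSpace X] {β : Type} [Fintype β]
    (𝒟 : Set (Measure (X × ℤˣ))) (D : β → Measure (X × ℤˣ)) (hD : ∀ b, D b ∈ 𝒟)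
    (Φ : StatQuery X → ℝ) {τ τ' ε cnt p : ℝ} {N : ℕ} (hτ : 0 ≤ τ) (hττ' : τ ≤ τ')
    (hq : ∀ q : StatQuery X, ({b | τ < |∫ z, q.toFun z ∂(D b) - Φ q|} : Set β).ncard ≤ cnt)
    (hh : ∀ h : Hypothesis X,
      ({b | misclassificationError (D b) h.toFun < ε} : Set β).ncard ≤ cnt)
    (hlt : (N + 1) * cnt < p * Fintype.card β) :
    ¬ ∃ R : RandomizedSQAlgorithm X, R.Learns 𝒟 N τ' ε p := by
  classical
  rintro ⟨R, hR⟩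
  let _ := R.measurableSpace
  have := R.isProbabilityMeasure
  -- The adversarial oracle hides `b` behind the reference answer and tells the exact truth only
  -- when that answer is too inaccurate.
  let O : β → StatQuery X → ℝ := fun b q =>
    if |∫ z, q.toFun z ∂(D b) - Φ q| ≤ τ then Φ q else ∫ z, q.toFun z ∂(D b)
  have hOs : ∀ b, IsStatOracle (D b) τ' (O b) := by
    intro b q
    simp only [O]
    split_ifs with h
    · rw [abs_sub_comm]
      exact h.trans hττ'
    · simpa using hτ.trans hττ'
  choose G hGm hGp hG using fun b => hR (D b) (hD b) (O b) (hOs b)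
  have key := fun s => card_success_le D Φ τ ε cnt O (fun b q h => if_pos h) hq hh (R.alg s) N
  have hcnt : 0 ≤ cnt := le_trans (by positivity) (hh ⟨fun _ => 1, measurable_const⟩)
  have h1 : ∑ b, R.law (G b) = ∫⁻ s, (∑ b, (G b).indicator (1 : R.Seed → ENNReal) s) ∂(R.law) := by
    rw [lintegral_finsetSum _ fun b _ => measurable_one.indicator (hGm b)]
    simp [hGm]
  have h2 : ∀ s, ∑ b, (G b).indicator (1 : R.Seed → ENNReal) s ≤
      ENNReal.ofReal ((N + 1) * cnt) := by
    intro s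
    have : ∑ b, (G b).indicator (1 : R.Seed → ENNReal) s = (({b | s ∈ G b} : Set β).ncard : ℕ) := by
      rw [Set.ncard_eq_toFinset_card']
      simp [Set.indicator_apply, Finset.sum_boole]
    rw [this, ← ENNReal.ofReal_natCast]
    refine ENNReal.ofReal_le_ofReal (le_trans ?_ (key s))
    exact_mod_cast Set.ncard_le_ncard (fun b hb => hG b s hb) (Set.toFinite _)
  have h3 : ∑ b, R.law (G b) ≤ ENNReal.ofReal ((N + 1) * cnt) := by
    rw [h1]
    refine (lintegral_mono h2).trans ?_
    simp
  have h4 : ENNReal.ofReal (p * Fintype.card β) ≤ ∑ b, R.law (G b) := by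
    have : ENNReal.ofReal (p * Fintype.card β) = ∑ _b : β, ENNReal.ofReal p := by
      rw [mul_comm, ENNReal.ofReal_mul (by positivity)]
      simp
    rw [this]
    exact Finset.sum_le_sum fun b _ => hGp b
  have h5 := h4.trans h3
  rw [ENNReal.ofReal_le_ofReal_iff (by positivity)] at h5
  linarith

/-! ### Smoothed parities and their pairwise correlations -/

/-- The mean of the values of `f` at two consecutive integers. -/
noncomputable def consecutiveMean (f : ℤ → ℝ) (z : ℤ) : ℝ := (f z + f (z + 1)) / 2

lemma abs_consecutiveMean_le {f : ℤ → ℝ} (hf : ∀ z, |f z| ≤ 1) (z : ℤ) :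
    |consecutiveMean f z| ≤ 1 := by
  have h1 := abs_le.1 (hf z)
  have h2 := abs_le.1 (hf (z + 1))
  rw [consecutiveMean, abs_le]
  constructor <;> linarith

lemma abs_iterate_consecutiveMean_le {f : ℤ → ℝ} (hf : ∀ z, |f z| ≤ 1) (k : ℕ) :
    ∀ z, |consecutiveMean^[k] f z| ≤ 1 := by
  induction k with
  | zero => simpa using hf
  | succ k ih =>
    rw [Function.iterate_succ_apply']
    exact abs_consecutiveMean_le ih

lemma iterate_consecutiveMean_eq {f : ℤ → ℝ} {a : ℝ} (k : ℕ) :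
    ∀ z : ℤ, (∀ u, z ≤ u → u ≤ z + k → f u = a) → consecutiveMean^[k] f z = a := by
  induction k with
  | zero => intro z h; simpa using h z le_rfl (by simp)
  | succ k ih =>
    intro z h
    rw [Function.iterate_succ_apply', consecutiveMean,
      ih z fun u h1 h2 => h u h1 (by push_cast; linarith),
      ih (z + 1) fun u h1 h2 => h u (by linarith) (by push_cast; linarith)]
    ring

lemma iterate_consecutiveMean_affine (f : ℤ → ℝ) (k : ℕ) :
    ∀ z, consecutiveMean^[k] (fun u => 1 - 2 * f u) z = 1 - 2 * consecutiveMean^[k] f z := by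
  induction k with
  | zero => intro z; rfl
  | succ k ih =>
    intro z
    rw [Function.iterate_succ_apply', Function.iterate_succ_apply', consecutiveMean,
      consecutiveMean, ih, ih]
    ring

/-- The sum telescopes: each mean shares a value with the next one, with opposite signs. This is the
source of all cancellation in the proof. -/
lemma sum_alternating_consecutiveMean (f : ℤ → ℝ) (c : ℤ) (w : ℕ) :
    ∑ a : Fin w, (-1 : ℝ) ^ (a : ℕ) * consecutiveMean f (c + a) =
      (f c - (-1) ^ w * f (c + w)) / 2 := by
  rw [Fin.sum_univ_eq_sum_range (fun a : ℕ => (-1 : ℝ) ^ a * consecutiveMean f (c + a))]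
  induction w with
  | zero => simp
  | succ w ih =>
    rw [Finset.sum_range_succ, ih, consecutiveMean]
    push_cast
    rw [pow_succ, add_assoc]
    ring

/-- The coordinate of a pair which is selected by a bit. -/
def selectCoord {α : Type} (b : Bool) (p : α × α) : α := if b then p.1 else p.2

/-- The sum of the selected coordinates, where `Fin (2 * v + 1)` stands for the integers from `-v`
to `v`. -/
def hiddenSum {m v : ℕ} (b : Fin m → Bool) (x : Fin m → Fin (2 * v + 1) × Fin (2 * v + 1)) : ℤ :=
  ∑ i, (((selectCoord (b i) (x i) : Fin (2 * v + 1)) : ℕ) - v : ℤ)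

lemma sum_fin_succ_pi {α : Type} [Fintype α] {m : ℕ} (Q : (Fin (m + 1) → α) → ℝ) :
    ∑ x, Q x = ∑ a : α, ∑ x : Fin m → α, Q (Fin.cons a x) := by
  rw [← Fintype.sum_prod_type', ← (Fin.consEquiv fun _ => α).sum_comp]
  rfl

lemma hiddenSum_cons {m v : ℕ} (b : Fin (m + 1) → Bool) (a : Fin (2 * v + 1) × Fin (2 * v + 1))
    (x : Fin m → Fin (2 * v + 1) × Fin (2 * v + 1)) :
    hiddenSum b (Fin.cons a x) =
      (((selectCoord (b 0) a : Fin (2 * v + 1)) : ℕ) - v : ℤ) +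
        hiddenSum (fun i => b i.succ) x := by
  rw [hiddenSum, Fin.sum_univ_succ]
  rfl

/-- The number of indices at which two bit vectors differ. -/
def bitDistance {m : ℕ} (b b' : Fin m → Bool) : ℕ := ∑ i, if b i = b' i then 0 else 1

/-- Where the bits differ, the integer selected by `b` does not affect the sum selected by `b'`, so
it can be summed out with `H` frozen. The alternating sum over its `2 * v + 1` values collapses to
half the sum of two boundary terms, at the price of one of the `k` means. The shifts `c`, `c'` are
there for the induction over the pairs. -/
theorem abs_correlation_le (v m : ℕ) : ∀ (k : ℕ) (b b' : Fin m → Bool), k ≤ bitDistance b b' →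
    ∀ (F H : ℤ → ℝ), (∀ z, |F z| ≤ 1) → (∀ z, |H z| ≤ 1) → ∀ c c' : ℤ,
    |∑ x : Fin m → Fin (2 * v + 1) × Fin (2 * v + 1), (-1 : ℝ) ^ (hiddenSum b x) *
      consecutiveMean^[k] F (c + hiddenSum b x) * H (c' + hiddenSum b' x)| ≤
      ((2 * v + 1 : ℝ) ^ 2) ^ m / (2 * v + 1) ^ k := by
  induction m with
  | zero =>
    intro k b b' hk F H hF hH c c'
    obtain rfl : k = 0 := by simpa [bitDistance] using hk
    simp only [hiddenSum, Finset.univ_eq_empty, Finset.sum_empty, Function.iterate_zero, id,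
      Finset.univ_unique, Finset.sum_singleton, zpow_zero, one_mul, add_zero, pow_zero, div_one,
      abs_mul]
    exact mul_le_one₀ (hF _) (abs_nonneg _) (hH _)
  | succ m ih =>
    intro k b b' hk F H hF hH c c'
    have hw : (0 : ℝ) < 2 * v + 1 := by positivity
    rw [sum_fin_succ_pi]
    simp only [hiddenSum_cons]
    have hd : bitDistance b b' = (if b 0 = b' 0 then 0 else 1) +
        bitDistance (fun i => b i.succ) (fun i => b' i.succ) := by
      simp [bitDistance, Fin.sum_univ_succ]
    have hsgn : ∀ z : ℤ, |(-1 : ℝ) ^ z| = 1 := fun z => by simp [abs_zpow]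
    have same : ∀ (j : ℕ), j ≤ bitDistance (fun i => b i.succ) (fun i => b' i.succ) →
        ∀ (F : ℤ → ℝ), (∀ z, |F z| ≤ 1) → ∀ u u' e : ℤ,
        |∑ x : Fin m → Fin (2 * v + 1) × Fin (2 * v + 1),
          (-1 : ℝ) ^ (e + hiddenSum (fun i => b i.succ) x) *
          consecutiveMean^[j] F (u + hiddenSum (fun i => b i.succ) x) *
          H (u' + hiddenSum (fun i => b' i.succ) x)| ≤
        ((2 * v + 1 : ℝ) ^ 2) ^ m / (2 * v + 1) ^ j := by
      intro j hj F hF u u' e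
      have := ih j _ _ hj F H hF hH u u'
      simp only [zpow_add₀ (by norm_num : (-1 : ℝ) ≠ 0), mul_assoc]
      rw [← Finset.mul_sum, abs_mul, hsgn, one_mul]
      simpa only [mul_assoc] using this
    -- If the remaining pairs already supply `k` differences, the first pair is handled by the
    -- triangle inequality; otherwise its bits must differ and it supplies one factor.
    by_cases hb : k ≤ bitDistance (fun i => b i.succ) (fun i => b' i.succ)
    · refine (Finset.abs_sum_le_sum_abs _ _).trans ?_
      refine (Finset.sum_le_sum (g := fun _ => ((2 * v + 1 : ℝ) ^ 2) ^ m / (2 * v + 1) ^ k)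
        fun a _ => ?_).trans ?_
      · have := same k hb F hF (c + (((selectCoord (b 0) a : Fin (2 * v + 1)) : ℕ) - v))
          (c' + (((selectCoord (b' 0) a : Fin (2 * v + 1)) : ℕ) - v))
          (((selectCoord (b 0) a : Fin (2 * v + 1)) : ℕ) - v)
        simpa only [add_assoc] using this
      · simp only [Finset.sum_const, Finset.card_univ, Fintype.card_prod, Fintype.card_fin,
          nsmul_eq_mul]
        push_cast
        rw [pow_succ]
        apply le_of_eq; ring
    · have hne : b 0 ≠ b' 0 := by
        intro h; rw [hd, if_pos h] at hk; omega
      rw [hd, if_neg hne] at hk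
      obtain ⟨j, rfl⟩ : ∃ j, k = j + 1 := ⟨k - 1, by omega⟩
      have hj : j ≤ bitDistance (fun i => b i.succ) (fun i => b' i.succ) := by omega
      -- the summand depends on the two coordinates of the first pair separately
      have hsel : ∀ Q : Fin (2 * v + 1) → Fin (2 * v + 1) → ℝ,
          ∑ a : Fin (2 * v + 1) × Fin (2 * v + 1), Q (selectCoord (b 0) a) (selectCoord (b' 0) a) =
            ∑ a', ∑ a, Q a a' := by
        intro Q
        rcases h0 : b 0 <;> rcases h0' : b' 0 <;> simp_all [selectCoord, Fintype.sum_prod_type]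
        exact Finset.sum_comm
      rw [hsel fun a a' => ∑ x : Fin m → Fin (2 * v + 1) × Fin (2 * v + 1),
          (-1 : ℝ) ^ (((a : ℕ) - v : ℤ) + hiddenSum (fun i => b i.succ) x) *
          consecutiveMean^[j + 1] F (c + (((a : ℕ) - v : ℤ) + hiddenSum (fun i => b i.succ) x)) *
          H (c' + (((a' : ℕ) - v : ℤ) + hiddenSum (fun i => b' i.succ) x))]
      refine (Finset.abs_sum_le_sum_abs _ _).trans ?_
      refine (Finset.sum_le_sum (g := fun _ => ((2 * v + 1 : ℝ) ^ 2) ^ m / (2 * v + 1) ^ j)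
        fun a' _ => ?_).trans ?_
      · rw [Finset.sum_comm]
        -- Telescoping over `a`: the number of values is odd, so the two boundary terms enter with
        -- the same sign.
        have hx : ∀ x : Fin m → Fin (2 * v + 1) × Fin (2 * v + 1),
            ∑ a : Fin (2 * v + 1),
              (-1 : ℝ) ^ (((a : ℕ) - v : ℤ) + hiddenSum (fun i => b i.succ) x) *
              consecutiveMean^[j + 1] F
                (c + (((a : ℕ) - v : ℤ) + hiddenSum (fun i => b i.succ) x)) *
              H (c' + (((a' : ℕ) - v : ℤ) + hiddenSum (fun i => b' i.succ) x)) =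
            ((-1 : ℝ) ^ (-v + hiddenSum (fun i => b i.succ) x) *
              consecutiveMean^[j] F ((c - v) + hiddenSum (fun i => b i.succ) x) *
              H ((c' + ((a' : ℕ) - v : ℤ)) + hiddenSum (fun i => b' i.succ) x) +
            (-1 : ℝ) ^ (-v + hiddenSum (fun i => b i.succ) x) *
              consecutiveMean^[j] F ((c - v + (2 * v + 1)) + hiddenSum (fun i => b i.succ) x) *
              H ((c' + ((a' : ℕ) - v : ℤ)) + hiddenSum (fun i => b' i.succ) x)) / 2 := by
          intro x
          have h := sum_alternating_consecutiveMean (consecutiveMean^[j] F)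
            ((c - v) + hiddenSum (fun i => b i.succ) x) (2 * v + 1)
          rw [Odd.neg_one_pow ⟨v, rfl⟩] at h
          rw [Function.iterate_succ_apply']
          have h2 : ∀ a : Fin (2 * v + 1),
              (-1 : ℝ) ^ (((a : ℕ) - v : ℤ) + hiddenSum (fun i => b i.succ) x) *
              consecutiveMean (consecutiveMean^[j] F)
                (c + (((a : ℕ) - v : ℤ) + hiddenSum (fun i => b i.succ) x)) *
              H (c' + (((a' : ℕ) - v : ℤ) + hiddenSum (fun i => b' i.succ) x)) =
              ((-1 : ℝ) ^ (a : ℕ) * consecutiveMean (consecutiveMean^[j] F)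
                (c - v + hiddenSum (fun i => b i.succ) x + (a : ℕ))) *
              ((-1 : ℝ) ^ (-v + hiddenSum (fun i => b i.succ) x) *
              H ((c' + ((a' : ℕ) - v : ℤ)) + hiddenSum (fun i => b' i.succ) x)) := by
            intro a
            rw [show ((a : ℕ) - v : ℤ) + hiddenSum (fun i => b i.succ) x =
              ((a : ℕ) : ℤ) + (-v + hiddenSum (fun i => b i.succ) x) by ring,
              zpow_add₀ (by norm_num), zpow_natCast,
              show c + (((a : ℕ) : ℤ) + (-v + hiddenSum (fun i => b i.succ) x)) =
                c - v + hiddenSum (fun i => b i.succ) x + (a : ℕ) by ring, ← add_assoc c']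
            ring
          rw [Finset.sum_congr rfl fun a _ => h2 a, ← Finset.sum_mul, h]
          rw [show c - v + (2 * v + 1) + hiddenSum (fun i => b i.succ) x =
            c - v + hiddenSum (fun i => b i.succ) x + ((2 * v + 1 : ℕ) : ℤ) by push_cast; ring]
          ring
        rw [Finset.sum_congr rfl fun x _ => hx x, ← Finset.sum_div, Finset.sum_add_distrib]
        have h1 := abs_le.1 (same j hj F hF (c - v) (c' + ((a' : ℕ) - v : ℤ)) (-v))
        have h2 := abs_le.1 (same j hj F hF (c - v + (2 * v + 1)) (c' + ((a' : ℕ) - v : ℤ)) (-v))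
        rw [abs_le]
        constructor <;> linarith [h1.1, h1.2, h2.1, h2.2]
      · simp only [Finset.sum_const, Finset.card_univ, Fintype.card_fin, nsmul_eq_mul]
        push_cast
        apply le_of_eq
        rw [pow_succ, pow_succ _ j]
        field_simp
        ring

/-! ### Symmetry, close pairs and concentration -/

/-- The distribution of the hidden sum does not depend on the bits. -/
lemma sum_hiddenSum_eq {m v : ℕ} (b b' : Fin m → Bool) (Q : ℤ → ℝ) :
    ∑ x : Fin m → Fin (2 * v + 1) × Fin (2 * v + 1), Q (hiddenSum b x) =
      ∑ x : Fin m → Fin (2 * v + 1) × Fin (2 * v + 1), Q (hiddenSum b' x) := by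
  let e : (Fin m → Fin (2 * v + 1) × Fin (2 * v + 1)) ≃
      (Fin m → Fin (2 * v + 1) × Fin (2 * v + 1)) :=
    Equiv.piCongrRight fun i => if b i = b' i then Equiv.refl _ else Equiv.prodComm _ _
  rw [← e.sum_comp fun x => Q (hiddenSum b' x)]
  refine Finset.sum_congr rfl fun x _ => ?_
  congr 1
  refine Finset.sum_congr rfl fun i _ => ?_
  have : selectCoord (b' i) (e x i) = selectCoord (b i) (x i) := by
    simp only [e, Equiv.piCongrRight_apply, Pi.map_apply]
    rcases h : b i <;> rcases h' : b' i <;> simp [selectCoord]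
  rw [this]

/-- Few pairs of bit vectors are close. -/
lemma card_close_pairs_le (m k : ℕ) :
    ((Finset.univ.filter fun p : (Fin m → Bool) × (Fin m → Bool) => bitDistance p.1 p.2 < k).card
      : ℝ) ≤ 2 ^ k * 3 ^ m := by
  -- The generating function factorizes; one coordinate contributes `1 + 1 + 1/2 + 1/2 = 3`. The
  -- count then follows as in Markov's inequality.
  have h : ∀ m : ℕ, ∑ b : Fin m → Bool, ∑ b' : Fin m → Bool, (1 / 2 : ℝ) ^ bitDistance b b' =
      3 ^ m := by
    intro m
    induction m with
    | zero => simp [bitDistance]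
    | succ m ih =>
      have hd : ∀ (a a' : Bool) (b b' : Fin m → Bool),
          bitDistance (Fin.cons a b : Fin (m + 1) → Bool) (Fin.cons a' b' : Fin (m + 1) → Bool) =
          (if a = a' then 0 else 1) + bitDistance b b' := by
        intro a a' b b'; simp [bitDistance, Fin.sum_univ_succ]
      simp only [sum_fin_succ_pi, hd, pow_add, ← Finset.mul_sum, Fintype.sum_bool, ih,
        Finset.sum_add_distrib]
      norm_num
      ring
  rw [← h m, ← Fintype.sum_prod_type', Finset.mul_sum, Finset.card_eq_sum_ones, Nat.cast_sum,
    Finset.sum_filter]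
  refine Finset.sum_le_sum fun p _ => ?_
  split_ifs with hp
  · rw [one_div, inv_pow, Nat.cast_one, ← div_eq_mul_inv, one_le_div (by positivity)]
    exact pow_le_pow_right₀ (by norm_num) hp.le
  · positivity

/-- Hoeffding's lemma for the uniform law on `[-v, v]`: by symmetry `exp` may be replaced by `cosh`,
and `cosh x ≤ exp (x ^ 2 / 2)`. -/
lemma sum_exp_centered_le (v : ℕ) (s : ℝ) :
    ∑ a : Fin (2 * v + 1), Real.exp (s * ((a : ℕ) - v)) ≤
      (2 * v + 1) * Real.exp (s ^ 2 * v ^ 2 / 2) := by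
  have hrev : ∑ a : Fin (2 * v + 1), Real.exp (s * ((a : ℕ) - v)) =
      ∑ a : Fin (2 * v + 1), Real.exp (-(s * ((a : ℕ) - v))) := by
    rw [← Equiv.sum_comp Fin.revPerm]
    refine Finset.sum_congr rfl fun a _ => ?_
    rw [Fin.revPerm_apply, Fin.val_rev, Nat.cast_sub (by omega)]
    congr 1
    push_cast
    ring_nf
  have h : ∑ a : Fin (2 * v + 1), Real.exp (s * ((a : ℕ) - v)) =
      ∑ a : Fin (2 * v + 1), Real.cosh (s * ((a : ℕ) - v)) := by
    simp only [Real.cosh_eq, ← Finset.sum_div, Finset.sum_add_distrib, ← hrev]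
    ring
  rw [h]
  refine (Finset.sum_le_sum (g := fun _ => Real.exp (s ^ 2 * v ^ 2 / 2)) fun a _ => ?_).trans ?_
  · refine (Real.cosh_le_exp_half_sq _).trans (Real.exp_le_exp.2 ?_)
    have ha : ((a : ℕ) : ℝ) ≤ 2 * v := by exact_mod_cast Nat.lt_succ_iff.1 a.2
    have ha0 : (0 : ℝ) ≤ (a : ℕ) := by positivity
    have : (((a : ℕ) : ℝ) - v) ^ 2 ≤ v ^ 2 := by nlinarith
    rw [mul_pow]
    have := mul_le_mul_of_nonneg_left this (sq_nonneg s)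
    linarith
  · simp

lemma sum_exp_hiddenSum_le {m v : ℕ} (b : Fin m → Bool) (s : ℝ) :
    ∑ x : Fin m → Fin (2 * v + 1) × Fin (2 * v + 1), Real.exp (s * hiddenSum b x) ≤
      ((2 * v + 1) ^ 2) ^ m * Real.exp (m * (s ^ 2 * v ^ 2 / 2)) := by
  induction m with
  | zero => simp [hiddenSum]
  | succ m ih =>
    rw [sum_fin_succ_pi]
    simp only [hiddenSum_cons, Int.cast_add, mul_add, Real.exp_add, ← Finset.mul_sum]
    rw [← Finset.sum_mul]
    have h1 : ∑ a : Fin (2 * v + 1) × Fin (2 * v + 1),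
        Real.exp (s * (((((selectCoord (b 0) a : Fin (2 * v + 1)) : ℕ) - v : ℤ)) : ℝ)) ≤
        (2 * v + 1) * ((2 * v + 1) * Real.exp (s ^ 2 * v ^ 2 / 2)) := by
      refine le_trans (le_of_eq ?_)
        (mul_le_mul_of_nonneg_left (sum_exp_centered_le v s) (by positivity))
      push_cast
      rcases h0 : b 0 <;> simp [selectCoord, Fintype.sum_prod_type, Finset.mul_sum]
    refine (mul_le_mul h1 (ih _) (by positivity) (by positivity)).trans (le_of_eq ?_)
    rw [Nat.cast_succ, add_mul (m : ℝ), Real.exp_add]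
    ring_nf

/-- Concentration of the hidden sum. -/
lemma card_hiddenSum_large_le {m v : ℕ} (b : Fin m → Bool) {s : ℝ} (hs : 0 ≤ s) (r : ℝ) :
    ((Finset.univ.filter fun x : Fin m → Fin (2 * v + 1) × Fin (2 * v + 1) =>
      r < |(hiddenSum b x : ℝ)|).card : ℝ) ≤
      2 * ((2 * v + 1) ^ 2) ^ m * Real.exp (m * (s ^ 2 * v ^ 2 / 2) - s * r) := by
  have h1 := sum_exp_hiddenSum_le (v := v) b s
  have h2 := sum_exp_hiddenSum_le (v := v) b (-s)
  rw [Finset.card_eq_sum_ones, Nat.cast_sum, Finset.sum_filter, sub_eq_add_neg, Real.exp_add]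
  -- Chernoff's method for both tails at once: where the absolute value exceeds `r`, one of the two
  -- exponentials is at least `exp (s * r)`.
  have h3 : ∑ x : Fin m → Fin (2 * v + 1) × Fin (2 * v + 1),
      (if r < |(hiddenSum b x : ℝ)| then ((1 : ℕ) : ℝ) else 0) ≤
      ∑ x : Fin m → Fin (2 * v + 1) × Fin (2 * v + 1),
        (Real.exp (s * hiddenSum b x) + Real.exp (-s * hiddenSum b x)) * Real.exp (-(s * r)) := by
    refine Finset.sum_le_sum fun x _ => ?_
    split_ifs with hx
    · rw [add_mul, ← Real.exp_add, ← Real.exp_add, Nat.cast_one]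
      rcases lt_abs.1 hx with h | h
      · have : 1 ≤ Real.exp (s * hiddenSum b x + -(s * r)) := by
          rw [Real.one_le_exp_iff]; nlinarith
        linarith [Real.exp_pos (-s * hiddenSum b x + -(s * r))]
      · have : 1 ≤ Real.exp (-s * hiddenSum b x + -(s * r)) := by
          rw [Real.one_le_exp_iff]; nlinarith
        linarith [Real.exp_pos (s * hiddenSum b x + -(s * r))]
    · positivity
  refine h3.trans ?_
  rw [← Finset.sum_mul, Finset.sum_add_distrib, ← mul_assoc]
  refine mul_le_mul_of_nonneg_right ?_ (by positivity)
  rw [neg_sq] at h2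
  linarith

/-! ### Second-moment bound for nearly uncorrelated families -/

/-- A bounded function correlates with few members of a family whose members are nearly
uncorrelated for all but a few pairs. -/
theorem card_large_correlation_le {Ω β : Type} [Fintype Ω] [Fintype β] (F : β → Ω → ℝ)
    (hF : ∀ b x, |F b x| ≤ 1) (bad : β × β → Prop) [DecidablePred bad] (ν δ τ : ℝ)
    (hbad : ((Finset.univ.filter bad).card : ℝ) ≤ δ)
    (hgood : ∀ b b', ¬ bad (b, b') → |∑ x, F b x * F b' x| ≤ ν * Fintype.card Ω)
    (hν0 : 0 ≤ ν) (hτ : 0 ≤ τ) (hν : ν ≤ τ ^ 2 / 2) (hΩ : 0 < Fintype.card Ω)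
    (u : Ω → ℝ) (hu : ∀ x, |u x| ≤ 1) :
    (({b | τ * Fintype.card Ω < |∑ x, u x * F b x|} : Set β).ncard : ℝ) ^ 2 * τ ^ 2 ≤ 2 * δ := by
  classical
  rw [Set.ncard_eq_toFinset_card']
  set B := ({b | τ * Fintype.card Ω < |∑ x, u x * F b x|} : Set β).toFinset with hB
  obtain ⟨Z, hZ⟩ : ∃ Z : ℝ, Z = Fintype.card Ω := ⟨_, rfl⟩
  have hZ0 : 0 < Z := by rw [hZ]; exact_mod_cast hΩ
  rw [← hZ] at hB
  simp only [← hZ] at hgood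
  -- The signs turn the absolute correlations into the correlation of `u` with one signed sum over
  -- `B`, whose square norm the pairwise bounds control via Cauchy–Schwarz.
  let s : β → ℝ := fun b => SignType.sign (∑ x, u x * F b x)
  have hs : ∀ b, |s b| ≤ 1 := by
    intro b
    simp only [s]
    rcases SignType.sign (∑ x, u x * F b x) <;> simp
  have h1 : B.card * (τ * Z) ≤ ∑ x, u x * ∑ b ∈ B, s b * F b x := by
    have : ∑ x, u x * ∑ b ∈ B, s b * F b x = ∑ b ∈ B, |∑ x, u x * F b x| := by
      simp only [Finset.mul_sum]
      rw [Finset.sum_comm]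
      refine Finset.sum_congr rfl fun b _ => ?_
      rw [← sign_mul_self, Finset.mul_sum]
      exact Finset.sum_congr rfl fun x _ => by simp only [s]; ring
    rw [this, ← nsmul_eq_mul]
    refine Finset.card_nsmul_le_sum _ _ _ fun b hb => ?_
    exact le_of_lt (by simpa [hB] using hb)
  have h2 : (∑ x, u x * ∑ b ∈ B, s b * F b x) ^ 2 ≤ Z * ∑ x, (∑ b ∈ B, s b * F b x) ^ 2 := by
    refine (Finset.sum_mul_sq_le_sq_mul_sq _ _ _).trans ?_
    refine mul_le_mul_of_nonneg_right ?_ (Finset.sum_nonneg fun x _ => sq_nonneg _)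
    refine (Finset.sum_le_sum (g := fun _ => (1 : ℝ)) fun x _ => ?_).trans (by simp [hZ])
    exact (sq_le_one_iff_abs_le_one _).2 (hu x)
  have h3 : ∑ x, (∑ b ∈ B, s b * F b x) ^ 2 ≤ (B.card : ℝ) ^ 2 * (ν * Z) + δ * Z := by
    have e : ∑ x, (∑ b ∈ B, s b * F b x) ^ 2 =
        ∑ p ∈ B ×ˢ B, s p.1 * s p.2 * ∑ x, F p.1 x * F p.2 x := by
      have h4 : ∀ x, (∑ b ∈ B, s b * F b x) ^ 2 =
          ∑ p ∈ B ×ˢ B, s p.1 * s p.2 * (F p.1 x * F p.2 x) := by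
        intro x
        rw [sq, Finset.sum_mul_sum, ← Finset.sum_product']
        exact Finset.sum_congr rfl fun p _ => by ring
      rw [Finset.sum_congr rfl fun x _ => h4 x, Finset.sum_comm]
      exact Finset.sum_congr rfl fun p _ => (Finset.mul_sum _ _ _).symm
    rw [e]
    have hp : ∀ p ∈ B ×ˢ B, s p.1 * s p.2 * ∑ x, F p.1 x * F p.2 x ≤
        ν * Z + if bad p then Z else 0 := by
      intro p _
      have h4 : s p.1 * s p.2 * ∑ x, F p.1 x * F p.2 x ≤ |∑ x, F p.1 x * F p.2 x| := by
        refine (le_abs_self _).trans ?_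
        rw [abs_mul, abs_mul]
        exact mul_le_of_le_one_left (abs_nonneg _)
          (mul_le_one₀ (hs _) (abs_nonneg _) (hs _))
      refine h4.trans ?_
      split_ifs with hb
      · have : |∑ x, F p.1 x * F p.2 x| ≤ Z := by
          refine (Finset.abs_sum_le_sum_abs _ _).trans ?_
          refine (Finset.sum_le_sum (g := fun _ => (1 : ℝ)) fun x _ => ?_).trans (by simp [hZ])
          rw [abs_mul]
          exact mul_le_one₀ (hF _ _) (abs_nonneg _) (hF _ _)
        nlinarith [mul_nonneg hν0 hZ0.le]
      · rw [add_zero]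
        exact hgood _ _ hb
    refine (Finset.sum_le_sum hp).trans ?_
    rw [Finset.sum_add_distrib, Finset.sum_const, Finset.card_product, nsmul_eq_mul,
      ← Finset.sum_filter, Finset.sum_const, nsmul_eq_mul]
    push_cast
    have : (((B ×ˢ B).filter bad).card : ℝ) ≤ δ := by
      refine le_trans ?_ hbad
      exact_mod_cast Finset.card_le_card (Finset.filter_subset_filter _ (Finset.subset_univ _))
    nlinarith [mul_le_mul_of_nonneg_right this hZ0.le]
  have h5 : ((B.card : ℝ) * (τ * Z)) ^ 2 ≤ Z * ((B.card : ℝ) ^ 2 * (ν * Z) + δ * Z) := by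
    refine (pow_le_pow_left₀ (by positivity) h1 2).trans (h2.trans ?_)
    exact mul_le_mul_of_nonneg_left h3 hZ0.le
  have h6 : (B.card : ℝ) ^ 2 * τ ^ 2 * Z ^ 2 ≤ ((B.card : ℝ) ^ 2 * ν + δ) * Z ^ 2 := by
    nlinarith
  have h7 := le_of_mul_le_mul_right h6 (by positivity)
  -- As `ν ≤ τ ^ 2 / 2`, the contribution of the good pairs is absorbed by half of the left side.
  nlinarith [mul_le_mul_of_nonneg_left hν (sq_nonneg (B.card : ℝ))]

/-! ### Linearization by monomial features -/

/-- Injective feature map into `ℝ ^ M` for which all combinations of the given features are linear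
functionals. -/
lemma exists_feature_embedding {Ω ι : Type} [Fintype Ω] [Fintype ι] (φ : Ω → ι → ℝ) {M : ℕ}
    (hM : Fintype.card ι + 1 ≤ M) :
    ∃ Ψ : Ω → EuclideanSpace ℝ (Fin M), Function.Injective Ψ ∧
      ∀ c : ι → ℝ, ∃ w : EuclideanSpace ℝ (Fin M), ∀ ω, inner ℝ w (Ψ ω) = ∑ i, c i * φ ω i := by
  classical
  obtain ⟨e⟩ : Nonempty (Option ι ↪ Fin M) :=
    Function.Embedding.nonempty_of_card_le (by simpa using hM)
  -- The extra coordinate numbers the points to force injectivity; the normal vectors below vanish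
  -- on it.
  let φ' : Ω → Option ι → ℝ := fun ω o => o.elim ((Fintype.equivFin Ω ω : ℕ) : ℝ) (φ ω)
  refine ⟨fun ω => WithLp.toLp 2 (Function.extend e (φ' ω) 0), ?_, fun c => ?_⟩
  · intro ω ω' h
    have h1 := congrArg (fun x : EuclideanSpace ℝ (Fin M) => x (e none)) h
    simp only [e.injective.extend_apply] at h1
    have h2 : ((Fintype.equivFin Ω ω : ℕ) : ℝ) = (Fintype.equivFin Ω ω' : ℕ) := h1
    exact (Fintype.equivFin Ω).injective (Fin.ext (by exact_mod_cast h2))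
  · refine ⟨WithLp.toLp 2 (Function.extend e (fun o : Option ι => o.elim 0 c) 0), fun ω => ?_⟩
    have h : ∀ j, j ∉ Finset.univ.map e → Function.extend e (φ' ω) 0 j *
        Function.extend e (fun o : Option ι => o.elim 0 c) 0 j = 0 := by
      intro j hj
      rw [Function.extend_apply' _ _ _ (by simpa using hj)]
      simp
    rw [PiLp.inner_apply]
    simp only [RCLike.inner_apply, conj_trivial]
    rw [← Finset.sum_subset (Finset.subset_univ (Finset.univ.map e)) fun j _ hj => h j hj,
      Finset.sum_map]
    simp [e.injective.extend_apply, Fintype.sum_option, φ', mul_comm]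

/-- Exponent vectors of monomials of degree at most `D`. -/
abbrev BoundedExponent (σ : Type) [Fintype σ] (D : ℕ) : Type :=
  {s : σ → Fin (D + 1) // ∑ i, (s i : ℕ) ≤ D}

/-- Give each exponent vector the weight `q ^ degree` with `q = 1 / (J + 1)`. Those of degree at
most `D` weigh at least `q ^ D`, and the total factorizes into geometric sums bounded by `1 / (1 -
q) = 1 + 1 / J`. -/
lemma card_boundedExponent_le (σ : Type) [Fintype σ] [DecidableEq σ] (D : ℕ) {J : ℝ} (hJ : 0 < J) :
    (Fintype.card (BoundedExponent σ D) : ℝ) ≤ (J + 1) ^ D * (1 + 1 / J) ^ Fintype.card σ := by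
  set q : ℝ := 1 / (J + 1) with hq
  have hq0 : 0 < q := by positivity
  have hq1 : q < 1 := by rw [hq, div_lt_one (by positivity)]; linarith
  have h1 : (Fintype.card (BoundedExponent σ D) : ℝ) * q ^ D ≤
      ∑ s : σ → Fin (D + 1), ∏ i, q ^ (s i : ℕ) := by
    have : (Fintype.card (BoundedExponent σ D) : ℝ) * q ^ D =
        ∑ s : σ → Fin (D + 1), if ∑ i, (s i : ℕ) ≤ D then q ^ D else 0 := by
      rw [Fintype.card_subtype, ← Finset.sum_filter, Finset.sum_const, nsmul_eq_mul]
    rw [this]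
    refine Finset.sum_le_sum fun s _ => ?_
    split_ifs with h
    · rw [Finset.prod_pow_eq_pow_sum]
      exact pow_le_pow_of_le_one hq0.le hq1.le h
    · positivity
  have h2 : ∑ s : σ → Fin (D + 1), ∏ i, q ^ (s i : ℕ) =
      (∑ j : Fin (D + 1), q ^ (j : ℕ)) ^ Fintype.card σ := by
    have := Finset.prod_univ_sum (fun _ : σ => (Finset.univ : Finset (Fin (D + 1))))
      (fun _ j => q ^ (j : ℕ))
    rw [Fintype.piFinset_univ] at this
    rw [← this, Finset.prod_const, Finset.card_univ]
  have h3 : ∑ j : Fin (D + 1), q ^ (j : ℕ) ≤ 1 + 1 / J := by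
    rw [Fin.sum_univ_eq_sum_range (fun j => q ^ j)]
    have h4 : (∑ j ∈ Finset.range (D + 1), q ^ j) * (1 - q) ≤ 1 := by
      have := geom_sum_mul q (D + 1)
      nlinarith [pow_pos hq0 (D + 1)]
    have h5 : 1 - q = 1 / (1 + 1 / J) := by rw [hq]; field_simp; ring
    rw [h5, mul_one_div, div_le_one (by positivity)] at h4
    exact h4
  rw [h2] at h1
  have h6 : (Fintype.card (BoundedExponent σ D) : ℝ) * q ^ D ≤ (1 + 1 / J) ^ Fintype.card σ :=
    h1.trans (pow_le_pow_left₀ (Finset.sum_nonneg fun _ _ => by positivity) h3 _)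
  rw [hq, one_div, inv_pow, ← div_eq_mul_inv, div_le_iff₀ (by positivity)] at h6
  linarith

lemma exists_monomial_coefficients {σ : Type} [Fintype σ] [DecidableEq σ] {D : ℕ} (Q : MvPolynomial σ ℝ)
    (hQ : Q.totalDegree ≤ D) :
    ∃ c : BoundedExponent σ D → ℝ, ∀ x : σ → ℝ,
      MvPolynomial.eval x Q = ∑ s, c s * ∏ i, x i ^ (s.1 i : ℕ) := by
  classical
  let g : BoundedExponent σ D → (σ →₀ ℕ) := fun s =>
    Finsupp.equivFunOnFinite.symm fun i => (s.1 i : ℕ)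
  have hg : Function.Injective g := by
    intro s s' h
    have h1 := Finsupp.equivFunOnFinite.symm.injective h
    exact Subtype.ext (funext fun i => Fin.ext (congrFun h1 i))
  refine ⟨fun s => Q.coeff (g s), fun x => ?_⟩
  rw [MvPolynomial.eval_eq']
  have h1 : ∑ s, Q.coeff (g s) * ∏ i, x i ^ (s.1 i : ℕ) =
      ∑ d ∈ Finset.univ.image g, Q.coeff d * ∏ i, x i ^ d i := by
    rw [Finset.sum_image fun a _ b _ h => hg h]
    rfl
  rw [h1]
  refine Finset.sum_subset (fun d hd => ?_) fun d _ hd => ?_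
  · have h2 : ∑ i, d i ≤ D := by
      have := MvPolynomial.le_totalDegree hd
      rw [Finsupp.sum_fintype _ _ (by simp)] at this
      exact this.trans hQ
    have h3 : ∀ i, d i < D + 1 := fun i =>
      Nat.lt_succ_iff.2 ((Finset.single_le_sum (fun _ _ => Nat.zero_le _)
        (Finset.mem_univ i)).trans h2)
    refine Finset.mem_image.2 ⟨⟨fun i => ⟨d i, h3 i⟩, h2⟩, Finset.mem_univ _, ?_⟩
    ext i
    rfl
  · rw [MvPolynomial.notMem_support_iff.1 hd, zero_mul]

/-! ### Discrete laws and membership in the Tsybakov model -/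

/-- The joint law of an example and its label with finitely many atoms `(Ψ ω, y)` of mass
`W ω y`. -/
noncomputable def discreteLaw {X Ω : Type} [MeasurableSpace X] [Fintype Ω] (Ψ : Ω → X)
    (W : Ω → ℤˣ → ℝ) : Measure (X × ℤˣ) :=
  ∑ ω, (ENNReal.ofReal (W ω 1) • Measure.dirac (Ψ ω, (1 : ℤˣ)) +
    ENNReal.ofReal (W ω (-1)) • Measure.dirac (Ψ ω, (-1 : ℤˣ)))

instance {X Ω : Type} [MeasurableSpace X] [Fintype Ω] (Ψ : Ω → X) (W : Ω → ℤˣ → ℝ) :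
    IsFiniteMeasure (discreteLaw Ψ W) := by
  refine ⟨?_⟩
  simp only [discreteLaw, Measure.finsetSum_apply, Measure.add_apply, Measure.smul_apply,
    Measure.dirac_apply_of_mem (Set.mem_univ _), smul_eq_mul, mul_one]
  exact ENNReal.sum_lt_top.2 fun ω _ => ENNReal.add_lt_top.2
    ⟨ENNReal.ofReal_lt_top, ENNReal.ofReal_lt_top⟩

instance : MeasurableSingletonClass ℤˣ := by
  refine ⟨fun y => ⟨{(y : ℤ)}, MeasurableSet.singleton _, ?_⟩⟩
  ext z
  simp [Units.ext_iff]

section discrete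

variable {X Ω : Type} [MeasurableSpace X] [MeasurableSingletonClass X] [Fintype Ω]

lemma integral_discreteLaw (Ψ : Ω → X) {W : Ω → ℤˣ → ℝ} (hW : ∀ ω y, 0 ≤ W ω y)
    (q : X × ℤˣ → ℝ) :
    ∫ z, q z ∂(discreteLaw Ψ W) =
      ∑ ω, (W ω 1 * q (Ψ ω, 1) + W ω (-1) * q (Ψ ω, -1)) := by
  have hi : ∀ (a : ℝ) (z : X × ℤˣ), Integrable q (ENNReal.ofReal a • Measure.dirac z) :=
    fun a z => (integrable_dirac (by finiteness)).smul_measure ENNReal.ofReal_ne_top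
  rw [discreteLaw, integral_finsetSum_measure fun ω _ => (hi _ _).add_measure (hi _ _)]
  refine Finset.sum_congr rfl fun ω _ => ?_
  rw [integral_add_measure (hi _ _) (hi _ _), integral_smul_measure, integral_smul_measure,
    integral_dirac, integral_dirac, ENNReal.toReal_ofReal (hW _ _),
    ENNReal.toReal_ofReal (hW _ _), smul_eq_mul, smul_eq_mul]

lemma misclassificationError_discreteLaw (Ψ : Ω → X) {W : Ω → ℤˣ → ℝ} (hW : ∀ ω y, 0 ≤ W ω y)
    {h : X → ℤˣ} (hh : Measurable h) :
    misclassificationError (discreteLaw Ψ W) h = ∑ ω, W ω (-h (Ψ ω)) := by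
  have hm : MeasurableSet {z : X × ℤˣ | h z.1 ≠ z.2} :=
    (measurableSet_eq_fun (hh.comp measurable_fst) measurable_snd).compl
  rw [misclassificationError, ← integral_indicator_one hm, integral_discreteLaw Ψ hW]
  refine Finset.sum_congr rfl fun ω _ => ?_
  rcases Int.units_eq_one_or (h (Ψ ω)) with h1 | h1 <;>
    simp [h1, show (-1 : ℤˣ) ≠ 1 by decide, show (1 : ℤˣ) ≠ -1 by decide]

/-- This turns a hypothesis into a statistical query, so that accurate hypotheses are counted like
distinguishing queries. -/
lemma misclassificationError_eq_correlation (Ψ : Ω → X) {W : Ω → ℤˣ → ℝ}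
    (hW : ∀ ω y, 0 ≤ W ω y) (hW1 : ∑ ω, (W ω 1 + W ω (-1)) = 1)
    {h : X → ℤˣ} (hh : Measurable h) :
    misclassificationError (discreteLaw Ψ W) h =
      (1 - ∫ z, ((z.2 : ℤ) : ℝ) * ((h z.1 : ℤ) : ℝ) ∂(discreteLaw Ψ W)) / 2 := by
  rw [misclassificationError_discreteLaw Ψ hW hh, integral_discreteLaw Ψ hW, ← hW1,
    ← Finset.sum_sub_distrib, Finset.sum_div]
  refine Finset.sum_congr rfl fun ω _ => ?_
  rcases Int.units_eq_one_or (h (Ψ ω)) with h1 | h1 <;> simp [h1]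

lemma noisyLabels_eq_discreteLaw {Ψ : Ω → X} {W : Ω → ℤˣ → ℝ} (hW : ∀ ω y, 0 ≤ W ω y)
    {f : X → ℤˣ} (hf : Measurable f) {η : X → ℝ} (hη : Measurable η)
    (h : ∀ ω, η (Ψ ω) * (W ω 1 + W ω (-1)) = W ω (-f (Ψ ω))) :
    noisyLabels (∑ ω, ENNReal.ofReal (W ω 1 + W ω (-1)) • Measure.dirac (Ψ ω)) f η =
      discreteLaw Ψ W := by
  classical
  have hadd : ∀ g : X → ℤˣ, Measurable g → ∀ ρ : X → ℝ, Measurable ρ →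
      ∀ s : Set (X × ℤˣ), MeasurableSet s →
      (((∑ ω, ENNReal.ofReal (W ω 1 + W ω (-1)) • Measure.dirac (Ψ ω)).withDensity
        fun x => ENNReal.ofReal (ρ x)).map (fun x => (x, g x))) s =
      ∑ ω, ENNReal.ofReal (W ω 1 + W ω (-1)) * ((fun x => (x, g x)) ⁻¹' s).indicator
        (fun x => ENNReal.ofReal (ρ x)) (Ψ ω) := by
    intro g hg ρ hρ s hs
    have hgm : Measurable fun x => (x, g x) := measurable_id.prodMk hg
    rw [Measure.map_apply hgm hs, withDensity_apply _ (hgm hs),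
      ← lintegral_indicator (hgm hs), lintegral_finsetSum_measure]
    simp only [lintegral_smul_measure, lintegral_dirac, smul_eq_mul]
  ext s hs
  rw [noisyLabels, Measure.add_apply, hadd f hf (fun x => 1 - η x) (measurable_const.sub hη) s hs,
    hadd (fun x => -f x) (measurable_of_countable (fun y : ℤˣ => -y) |>.comp hf) _ hη s hs,
    discreteLaw, Measure.finsetSum_apply, ← Finset.sum_add_distrib]
  refine Finset.sum_congr rfl fun ω _ => ?_
  have h1 : (1 - η (Ψ ω)) * (W ω 1 + W ω (-1)) = W ω (f (Ψ ω)) := by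
    rw [sub_mul, h, one_mul]
    rcases Int.units_eq_one_or (f (Ψ ω)) with h1 | h1 <;> simp [h1]
  have h0 : 0 ≤ W ω 1 + W ω (-1) := add_nonneg (hW _ _) (hW _ _)
  have e1 : ENNReal.ofReal (W ω 1 + W ω (-1)) * ENNReal.ofReal (η (Ψ ω)) =
      ENNReal.ofReal (W ω (-f (Ψ ω))) := by
    rw [← ENNReal.ofReal_mul h0, mul_comm, h]
  have e2 : ENNReal.ofReal (W ω 1 + W ω (-1)) * ENNReal.ofReal (1 - η (Ψ ω)) =
      ENNReal.ofReal (W ω (f (Ψ ω))) := by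
    rw [← ENNReal.ofReal_mul h0, mul_comm, h1]
  simp only [Set.indicator_apply, Set.mem_preimage, mul_ite, mul_zero, e1, e2,
    Measure.add_apply, Measure.smul_apply, smul_eq_mul, Measure.dirac_apply' _ hs, Pi.one_apply,
    mul_one]
  rcases Int.units_eq_one_or (f (Ψ ω)) with h2 | h2
  · simp [h2]
  · simp [h2, add_comm]

end discrete

lemma measurable_halfspace {M : ℕ} (w : EuclideanSpace ℝ (Fin M)) : Measurable (halfspace w) := by
  classical
  unfold halfspace
  refine Measurable.ite ?_ measurable_const measurable_const
  exact measurableSet_le measurable_const (by fun_prop)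

/-- A discrete law belongs to the Tsybakov noise model if the noise rate is bounded away from `1/2`
and positive only on an event of small probability. -/
theorem discreteLaw_mem_tsybakovHalfspaces {M : ℕ} {Ω : Type} [Fintype Ω]
    {Ψ : Ω → EuclideanSpace ℝ (Fin M)} (hΨ : Function.Injective Ψ) {W : Ω → ℤˣ → ℝ}
    (hW : ∀ ω y, 0 ≤ W ω y) (hW1 : ∑ ω, (W ω 1 + W ω (-1)) = 1)
    (w : EuclideanSpace ℝ (Fin M)) {t₀ A α B ζ : ℝ} (ht0 : 0 < t₀) (ht1 : t₀ ≤ 1 / 2)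
    (hA : 0 < A) (hα0 : 0 ≤ α / (1 - α)) (hαB : α / (1 - α) ≤ B)
    (hnoise : ∀ ω, W ω (-halfspace w (Ψ ω)) * (1 / 2 + t₀) ≤
      (1 / 2 - t₀) * W ω (halfspace w (Ψ ω)))
    (hopt : ∑ ω, W ω (-halfspace w (Ψ ω)) = ζ)
    (hsmall : ∑ ω, (if W ω (-halfspace w (Ψ ω)) = 0 then 0 else W ω 1 + W ω (-1)) ≤ A * t₀ ^ B)
    {T : Set ℝ} (hT : ∀ t ∈ T, 0 < t ∧ (t < 1 / 2 ∨ t = 1 / 2 ∧ (2 : ℝ) ^ (α / (1 - α)) ≤ A)) :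
    discreteLaw Ψ W ∈ tsybakovHalfspaces M T A α ζ := by
  classical
  set f := halfspace w with hf
  set μ : Ω → ℝ := fun ω => W ω 1 + W ω (-1) with hμ
  have hμ0 : ∀ ω, 0 ≤ μ ω := fun ω => add_nonneg (hW _ _) (hW _ _)
  have hμf : ∀ ω, μ ω = W ω (f (Ψ ω)) + W ω (-f (Ψ ω)) := by
    intro ω
    rcases Int.units_eq_one_or (f (Ψ ω)) with h1 | h1 <;> simp [h1, hμ, add_comm]
  set ηΩ : Ω → ℝ := fun ω => W ω (-f (Ψ ω)) / μ ω with hηΩ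
  have hη0 : ∀ ω, 0 ≤ ηΩ ω := fun ω => div_nonneg (hW _ _) (hμ0 _)
  have hη1 : ∀ ω, ηΩ ω ≤ 1 / 2 - t₀ := by
    intro ω
    refine div_le_of_le_mul₀ (hμ0 ω) (by linarith) ?_
    rw [hμf]
    have := hnoise ω
    linarith
  set η : EuclideanSpace ℝ (Fin M) → ℝ := Function.extend Ψ ηΩ 0 with hη
  have hηΨ : ∀ ω, η (Ψ ω) = ηΩ ω := fun ω => hΨ.extend_apply _ _ _
  have hηm : Measurable η := by
    have : η = fun x => ∑ ω, (({Ψ ω} : Set _).indicator (fun _ => ηΩ ω) x) := by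
      funext x
      by_cases hx : ∃ ω, Ψ ω = x
      · obtain ⟨ω, rfl⟩ := hx
        rw [hηΨ, Finset.sum_eq_single ω]
        · simp
        · intro ω' _ hne
          rw [Set.indicator_of_notMem]
          exact fun h => hne (hΨ h).symm
        · simp
      · rw [hη, Function.extend_apply' _ _ _ hx, Finset.sum_eq_zero]
        · rfl
        · intro ω _
          rw [Set.indicator_of_notMem]
          exact fun h => hx ⟨ω, h.symm⟩
    rw [this]
    exact Finset.measurable_sum _ fun ω _ => measurable_const.indicator (measurableSet_singleton _)
  have hηb : ∀ x, 0 ≤ η x ∧ η x ≤ 1 / 2 := by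
    intro x
    by_cases hx : ∃ ω, Ψ ω = x
    · obtain ⟨ω, rfl⟩ := hx
      rw [hηΨ]
      exact ⟨hη0 ω, (hη1 ω).trans (by linarith)⟩
    · rw [hη, Function.extend_apply' _ _ _ hx]
      simp
  have hfm : Measurable f := measurable_halfspace w
  set Dx : Measure (EuclideanSpace ℝ (Fin M)) :=
    ∑ ω, ENNReal.ofReal (W ω 1 + W ω (-1)) • Measure.dirac (Ψ ω) with hDx
  have hDxr : ∀ s : Set (EuclideanSpace ℝ (Fin M)), MeasurableSet s →
      Dx s = ENNReal.ofReal (∑ ω, if Ψ ω ∈ s then μ ω else 0) := by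
    intro s hs
    rw [ENNReal.ofReal_sum_of_nonneg fun ω _ => by split_ifs <;> simp [hμ0]]
    rw [hDx, Measure.finsetSum_apply]
    refine Finset.sum_congr rfl fun ω _ => ?_
    rw [Measure.smul_apply, Measure.dirac_apply' _ hs, Set.indicator_apply]
    split_ifs <;> simp [hμ]
  refine ⟨Dx, w, η, ⟨?_⟩, hηm, hηb, ?_, ?_, ?_⟩
  · rw [hDxr _ MeasurableSet.univ]
    simpa [hμ] using hW1
  · intro t ht
    have hm : MeasurableSet {x | 1 / 2 - t ≤ η x} := measurableSet_le measurable_const hηm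
    rw [Measure.real, hDxr _ hm, ENNReal.toReal_ofReal
      (Finset.sum_nonneg fun ω _ => by split_ifs <;> simp [hμ0])]
    simp only [Set.mem_ofPred_eq, hηΨ]
    obtain ⟨htpos, hcase⟩ := hT t ht
    rcases hcase with hlt | ⟨rfl, hA2⟩
    -- Below `t₀` the event is empty because `η ≤ 1/2 - t₀`. Between `t₀` and `1/2` it lies in the
    -- region of positive noise, whose mass is at most `A * t₀ ^ B`.
    · by_cases hlow : t < t₀
      · rw [Finset.sum_eq_zero fun ω _ => if_neg (by have := hη1 ω; linarith)]
        positivity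
      · push Not at hlow
        have h1 : ∑ ω, (if 1 / 2 - t ≤ ηΩ ω then μ ω else 0) ≤ A * t₀ ^ B := by
          refine le_trans (Finset.sum_le_sum fun ω _ => ?_) hsmall
          by_cases h0 : W ω (-f (Ψ ω)) = 0
          · have : ηΩ ω = 0 := by simp [hηΩ, h0]
            rw [if_neg (by rw [this]; linarith), if_pos h0]
          · rw [if_neg h0]
            split_ifs
            · exact le_rfl
            · exact hμ0 ω
        refine h1.trans (mul_le_mul_of_nonneg_left ?_ hA.le)
        calc t₀ ^ B ≤ t₀ ^ (α / (1 - α)) :=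
              Real.rpow_le_rpow_of_exponent_ge ht0 (by linarith) hαB
          _ ≤ t ^ (α / (1 - α)) := Real.rpow_le_rpow ht0.le hlow hα0
    · have h1 : ∑ ω, (if 1 / 2 - 1 / 2 ≤ ηΩ ω then μ ω else 0) ≤ 1 := by
        rw [← hW1]
        refine Finset.sum_le_sum fun ω _ => ?_
        split_ifs
        · exact le_rfl
        · exact hμ0 ω
      refine h1.trans ?_
      rw [one_div, Real.inv_rpow (by norm_num), ← div_eq_mul_inv, one_le_div (by positivity)]
      exact hA2
  · rw [hDx, noisyLabels_eq_discreteLaw hW hfm hηm]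
    intro ω
    rw [hηΨ]
    -- At a point of mass zero the quotient is `0` by convention, and both label masses vanish as
    -- well.
    refine div_mul_cancel_of_imp fun h => ?_
    have : μ ω = 0 := h
    rw [hμf] at this
    linarith [hW ω (f (Ψ ω)), hW ω (-f (Ψ ω))]
  · rw [misclassificationError_discreteLaw Ψ hW hfm, hopt]

/-! ### The window, the label densities and the majority label -/

/-- The indicator function of the integers between `-k` and `2 * k`, smoothed by `k` consecutive
means: it is `1` for `|z| ≤ k` and vanishes for `|z| > 2 * k`. -/
noncomputable def smoothWindow (k : ℕ) : ℤ → ℝ :=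
  consecutiveMean^[k] fun u => if -(k : ℤ) ≤ u ∧ u ≤ 2 * k then 1 else 0

/-- The `k`-fold mean at `z` sees only `[z, z + k]`; the asymmetric indicator compensates for this
one-sidedness. -/
lemma smoothWindow_eq_one {k : ℕ} {z : ℤ} (hz : |z| ≤ k) : smoothWindow k z = 1 := by
  have := abs_le.1 hz
  exact iterate_consecutiveMean_eq k z fun u h1 h2 => if_pos ⟨by linarith, by linarith⟩

lemma smoothWindow_eq_zero {k : ℕ} {z : ℤ} (hz : 2 * k < |z|) : smoothWindow k z = 0 := by
  refine iterate_consecutiveMean_eq k z fun u h1 h2 => if_neg fun h => ?_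
  rcases lt_abs.1 hz with h3 | h3 <;> linarith [h.1, h.2]

lemma abs_one_sub_two_mul_indicator_le (k : ℕ) (u : ℤ) :
    |1 - 2 * (if -(k : ℤ) ≤ u ∧ u ≤ 2 * k then (1 : ℝ) else 0)| ≤ 1 := by
  split_ifs <;> norm_num

lemma abs_one_sub_two_mul_smoothWindow_le (k : ℕ) (z : ℤ) : |1 - 2 * smoothWindow k z| ≤ 1 := by
  rw [smoothWindow, ← iterate_consecutiveMean_affine]
  exact abs_iterate_consecutiveMean_le (abs_one_sub_two_mul_indicator_le k) k z

/-- The density of the labelled examples with hidden sum `z` relative to the uniform distribution. -/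
noncomputable def labelWeight (k : ℕ) (t : ℝ) (z : ℤ) (y : ℤˣ) : ℝ :=
  if y = 1 then (1 / 2 + t) * (1 + (-1) ^ z)
  else (1 / 2 - t) * (1 + (-1) ^ z * (1 - 2 * smoothWindow k z))

/-- The more likely label of examples with hidden sum `z`. -/
def majorityLabel (k : ℕ) (z : ℤ) : ℤˣ := if Odd z ∧ |z| ≤ 2 * k then -1 else 1

section labelWeight

variable {k : ℕ} {t : ℝ}

lemma labelWeight_one (z : ℤ) : labelWeight k t z 1 = (1 / 2 + t) * (1 + (-1) ^ z) := if_pos rfl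

lemma labelWeight_neg_one (z : ℤ) : labelWeight k t z (-1) =
    (1 / 2 - t) * (1 + (-1) ^ z * (1 - 2 * smoothWindow k z)) :=
  if_neg (by decide)

lemma labelWeight_bounds (ht0 : 0 ≤ t) (ht : t ≤ 1 / 2) (z : ℤ) (y : ℤˣ) :
    0 ≤ labelWeight k t z y ∧ labelWeight k t z 1 + labelWeight k t z (-1) ≤ 2 := by
  have hw := abs_le.1 (abs_one_sub_two_mul_smoothWindow_le k z)
  rcases Int.even_or_odd z with hz | hz
  · rcases Int.units_eq_one_or y with rfl | rfl <;>
      rw [labelWeight_one, labelWeight_neg_one, hz.neg_one_zpow] <;> constructor <;> nlinarith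
  · rcases Int.units_eq_one_or y with rfl | rfl <;>
      rw [labelWeight_one, labelWeight_neg_one, hz.neg_one_zpow] <;> constructor <;> nlinarith

/-- At odd `z` the label `1` has weight zero, and beyond the window so has `-1`. At even `z` the
factor of `1` is the full `2` and that of `-1` is at most `2`, so the ratio of the prefactors
decides. -/
lemma labelWeight_minority_noise (ht0 : 0 ≤ t) (ht : t ≤ 1 / 2) (z : ℤ) :
    labelWeight k t z (-majorityLabel k z) * (1 / 2 + t) ≤
      (1 / 2 - t) * labelWeight k t z (majorityLabel k z) := by
  have hw := abs_le.1 (abs_one_sub_two_mul_smoothWindow_le k z)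
  have h0 := (labelWeight_bounds (k := k) ht0 ht z (majorityLabel k z)).1
  rw [majorityLabel] at h0 ⊢
  split_ifs at h0 ⊢ with h
  · rw [neg_neg, labelWeight_one, h.1.neg_one_zpow]
    nlinarith
  · rcases Int.even_or_odd z with hz | hz
    · rw [labelWeight_one, labelWeight_neg_one, hz.neg_one_zpow]
      have : 0 ≤ (1 / 2 - t) * (1 / 2 + t) := mul_nonneg (by linarith) (by linarith)
      nlinarith
    · rw [labelWeight_one, labelWeight_neg_one, hz.neg_one_zpow,
        smoothWindow_eq_zero (not_le.1 fun h' => h ⟨hz, h'⟩)]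
      norm_num

lemma labelWeight_minority_le (ht0 : 0 ≤ t) (z : ℤ) :
    labelWeight k t z (-majorityLabel k z) ≤ if (k : ℝ) < |(z : ℝ)| then 1 else 0 := by
  have hw := abs_le.1 (abs_one_sub_two_mul_smoothWindow_le k z)
  have hcast : (k : ℝ) < |(z : ℝ)| ↔ (k : ℤ) < |z| := by exact_mod_cast Iff.rfl
  rw [majorityLabel]
  split_ifs with h hk hk
  · rw [neg_neg, labelWeight_one, h.1.neg_one_zpow]; norm_num
  · rw [neg_neg, labelWeight_one, h.1.neg_one_zpow]; norm_num
  · rw [labelWeight_neg_one]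
    rcases Int.even_or_odd z with hz | hz <;> rw [hz.neg_one_zpow] <;> nlinarith
  · have hz : Even z := by
      rw [hcast, not_lt] at hk
      by_contra h'
      exact h ⟨Int.not_even_iff_odd.1 h', hk.trans (by linarith [Int.natCast_nonneg k])⟩
    rw [hcast, not_lt] at hk
    rw [labelWeight_neg_one, hz.neg_one_zpow, smoothWindow_eq_one hk]
    norm_num

end labelWeight

/-! ### Majority labels as halfspaces -/

/-- A polynomial which is negative at the odd integers with absolute value at most `2 * k` and
positive at the other integers. -/
lemma sign_prod_odd (k : ℕ) (z : ℤ) :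
    (0 ≤ ∏ u ∈ (Finset.Icc (-(2 * k) : ℤ) (2 * k)).filter Odd, (((z : ℝ) - u) ^ 2 - 1 / 4)) ↔
      majorityLabel k z = 1 := by
  have hpos : ∀ u : ℤ, u ≠ z → (0 : ℝ) < ((z : ℝ) - u) ^ 2 - 1 / 4 := by
    intro u hu
    have h1 : (1 : ℤ) ≤ (z - u) ^ 2 := by
      have : z - u ≠ 0 := sub_ne_zero.2 hu.symm
      have := Int.one_le_abs this
      nlinarith [sq_abs (z - u)]
    have h2 : (1 : ℝ) ≤ ((z : ℝ) - u) ^ 2 := by exact_mod_cast h1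
    linarith
  rw [majorityLabel]
  split_ifs with h
  · have hz : z ∈ (Finset.Icc (-(2 * k) : ℤ) (2 * k)).filter Odd := by
      have := abs_le.1 h.2
      simp only [Finset.mem_filter, Finset.mem_Icc]
      exact ⟨⟨this.1, this.2⟩, h.1⟩
    rw [← Finset.mul_prod_erase _ _ hz]
    have : 0 < ∏ u ∈ ((Finset.Icc (-(2 * k) : ℤ) (2 * k)).filter Odd).erase z,
        (((z : ℝ) - u) ^ 2 - 1 / 4) :=
      Finset.prod_pos fun u hu => hpos u (Finset.ne_of_mem_erase hu)
    simp only [show (-1 : ℤˣ) ≠ 1 by decide, iff_false, not_le]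
    rw [sub_self]
    nlinarith
  · refine iff_of_true (Finset.prod_nonneg fun u hu => (hpos u ?_).le) rfl
    rintro rfl
    simp only [Finset.mem_filter, Finset.mem_Icc] at hu
    exact h ⟨hu.2, abs_le.2 hu.1⟩

/-- One feature map represents all the hidden majority labels by halfspaces. -/
lemma exists_halfspace_embedding {m v k M : ℕ} (hk : 1 ≤ k)
    (hM : Fintype.card (BoundedExponent (Fin m × Bool) (10 * k)) + 1 ≤ M) :
    ∃ Ψ : Option (Fin m → Fin (2 * v + 1) × Fin (2 * v + 1)) → EuclideanSpace ℝ (Fin M),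
      Function.Injective Ψ ∧ ∀ b : Fin m → Bool, ∃ w : EuclideanSpace ℝ (Fin M),
        halfspace w (Ψ none) = 1 ∧
          ∀ x, halfspace w (Ψ (some x)) = majorityLabel k (hiddenSum b x) := by
  classical
  let pt : (Fin m → Fin (2 * v + 1) × Fin (2 * v + 1)) → Fin m × Bool → ℝ := fun x i =>
    ((selectCoord i.2 (x i.1) : Fin (2 * v + 1)) : ℕ) - v
  obtain ⟨Ψ, hΨ, hlin⟩ := exists_feature_embedding
    (fun (ω : Option (Fin m → Fin (2 * v + 1) × Fin (2 * v + 1)))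
      (s : BoundedExponent (Fin m × Bool) (10 * k)) =>
      ω.elim 0 fun x => ∏ i, pt x i ^ (s.1 i : ℕ)) hM
  refine ⟨Ψ, hΨ, fun b => ?_⟩
  let Q : MvPolynomial (Fin m × Bool) ℝ :=
    ∏ u ∈ (Finset.Icc (-(2 * k) : ℤ) (2 * k)).filter Odd,
      ((∑ i, MvPolynomial.X (i, b i) - MvPolynomial.C (u : ℝ)) ^ 2 - MvPolynomial.C (1 / 4))
  have hQ : Q.totalDegree ≤ 10 * k := by
    refine (MvPolynomial.totalDegree_finsetProd _ _).trans ?_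
    refine (Finset.sum_le_card_nsmul _ _ 2 fun u _ => ?_).trans ?_
    · refine (MvPolynomial.totalDegree_sub_C_le _ _).trans ?_
      refine (MvPolynomial.totalDegree_pow _ _).trans ?_
      have : (∑ i, MvPolynomial.X (i, b i) - MvPolynomial.C (u : ℝ) :
          MvPolynomial (Fin m × Bool) ℝ).totalDegree ≤ 1 := by
        refine (MvPolynomial.totalDegree_sub_C_le _ _).trans ?_
        refine MvPolynomial.totalDegree_finsetSum_le fun i _ => ?_
        rw [MvPolynomial.totalDegree_X]
      omega
    -- At most `4 * k + 1` quadratic factors give degree at most `8 * k + 2`, which is at most `10 *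
    -- k` as `k ≥ 1`.
    · have h1 := Finset.card_filter_le (Finset.Icc (-(2 * k) : ℤ) (2 * k)) Odd
      rw [Int.card_Icc] at h1
      rw [smul_eq_mul]
      omega
  obtain ⟨c, hc⟩ := exists_monomial_coefficients Q hQ
  obtain ⟨w, hw⟩ := hlin c
  refine ⟨w, ?_, fun x => ?_⟩
  -- The monomial features of the atom are all zero, so it lies on every hyperplane, where the label
  -- is `1` by convention.
  · rw [halfspace, hw none]
    simp
  · have hsum : ∑ i, pt x (i, b i) = (hiddenSum b x : ℝ) := by
      simp [pt, hiddenSum]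
    have heval : MvPolynomial.eval (pt x) Q =
        ∏ u ∈ (Finset.Icc (-(2 * k) : ℤ) (2 * k)).filter Odd,
          (((hiddenSum b x : ℝ) - u) ^ 2 - 1 / 4) := by
      simp only [Q, map_prod, map_sub, map_pow, map_sum, MvPolynomial.eval_X, MvPolynomial.eval_C,
        hsum]
    have hin : inner ℝ w (Ψ (some x)) = MvPolynomial.eval (pt x) Q := by
      rw [hw, hc]; rfl
    rw [halfspace, hin, heval]
    simp only [sign_prod_odd]
    split_ifs with h
    · exact h.symm
    · exact ((Int.units_eq_one_or _).resolve_left h).symm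

/-! ### The hidden family and statistical queries -/

/-- Few members of the family of windowed parities correlate with a given function. -/
lemma card_parity_correlation_le {m v k : ℕ} {F : ℤ → ℝ} (hF : ∀ z, |F z| ≤ 1) {τ : ℝ}
    (hτ : 0 ≤ τ) (hv : 1 / (2 * v + 1 : ℝ) ^ k ≤ τ ^ 2 / 2)
    {u : (Fin m → Fin (2 * v + 1) × Fin (2 * v + 1)) → ℝ} (hu : ∀ x, |u x| ≤ 1) :
    (({b | τ * ((2 * v + 1) ^ 2) ^ m <
      |∑ x, u x * ((-1) ^ hiddenSum b x * consecutiveMean^[k] F (hiddenSum b x))|} :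
        Set (Fin m → Bool)).ncard : ℝ) ^ 2 * τ ^ 2 ≤ 2 * (2 ^ k * 3 ^ m) := by
  classical
  have hcard : (Fintype.card (Fin m → Fin (2 * v + 1) × Fin (2 * v + 1)) : ℝ) =
      ((2 * v + 1) ^ 2) ^ m := by
    simp [sq]
  have hb : ∀ z : ℤ, |(-1 : ℝ) ^ z * consecutiveMean^[k] F z| ≤ 1 := by
    intro z
    rw [abs_mul, abs_zpow, abs_neg, abs_one, one_zpow, one_mul]
    exact abs_iterate_consecutiveMean_le hF k z
  have := card_large_correlation_le
    (fun (b : Fin m → Bool) (x : Fin m → Fin (2 * v + 1) × Fin (2 * v + 1)) =>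
      (-1 : ℝ) ^ hiddenSum b x * consecutiveMean^[k] F (hiddenSum b x))
    (fun b x => hb _) (fun p => bitDistance p.1 p.2 < k) (1 / (2 * v + 1 : ℝ) ^ k)
    (2 ^ k * 3 ^ m) τ (card_close_pairs_le m k)
    (fun b b' h => ?_) (by positivity) hτ hv Fintype.card_pos u hu
  · simpa only [hcard] using this
  · rw [hcard]
    have := abs_correlation_le v m k b b' (not_lt.1 h) F _ hF hb 0 0
    simp only [zero_add] at this
    exact this.trans (le_of_eq (by ring))

/-- The hidden distributions on the cube with an additional atom `none`. The parameters are the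
scale `s` of the weights on the cube and the masses `l₀`, `l₁` of the two labels of the atom. -/
noncomputable def hiddenWeight {m v : ℕ} (k : ℕ) (t s l₀ l₁ : ℝ) (b : Fin m → Bool) :
    Option (Fin m → Fin (2 * v + 1) × Fin (2 * v + 1)) → ℤˣ → ℝ
  | none, y => if y = 1 then l₁ else l₀
  | some x, y => s / ((2 * v + 1) ^ 2) ^ m * labelWeight k t (hiddenSum b x) y

/-- The expectation of a query if the labels of the points of the cube were independent of the
points. -/
noncomputable def referenceAnswer {m v : ℕ} {X : Type} [MeasurableSpace X]
    (Ψ : Option (Fin m → Fin (2 * v + 1) × Fin (2 * v + 1)) → X) (t s l₀ l₁ : ℝ)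
    (q : X × ℤˣ → ℝ) : ℝ :=
  (l₁ * q (Ψ none, 1) + l₀ * q (Ψ none, -1)) +
    s / ((2 * v + 1) ^ 2) ^ m * ∑ x, ((1 / 2 + t) * q (Ψ (some x), 1) +
      (1 / 2 - t) * q (Ψ (some x), -1))

section hidden

variable {m v k : ℕ} {t s l₀ l₁ : ℝ}

lemma hiddenWeight_nonneg (ht0 : 0 ≤ t) (ht : t ≤ 1 / 2) (hs : 0 ≤ s) (h₀ : 0 ≤ l₀) (h₁ : 0 ≤ l₁)
    (b : Fin m → Bool) (ω : Option (Fin m → Fin (2 * v + 1) × Fin (2 * v + 1))) (y : ℤˣ) :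
    0 ≤ hiddenWeight k t s l₀ l₁ b ω y := by
  rcases ω with _ | x
  · simp only [hiddenWeight]
    split_ifs <;> assumption
  · exact mul_nonneg (by positivity) (labelWeight_bounds ht0 ht _ _).1

/-- The atom cancels, and on each label slice only parity times a `k`-fold mean remains; the
constant `1` counts as its own `k`-fold mean. -/
lemma integral_hidden_sub_reference {X : Type} [MeasurableSpace X] [MeasurableSingletonClass X]
    (ht0 : 0 ≤ t) (ht : t ≤ 1 / 2) (hs : 0 ≤ s) (h₀ : 0 ≤ l₀) (h₁ : 0 ≤ l₁)
    (Ψ : Option (Fin m → Fin (2 * v + 1) × Fin (2 * v + 1)) → X) (b : Fin m → Bool)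
    (q : X × ℤˣ → ℝ) :
    ∫ z, q z ∂(discreteLaw Ψ (hiddenWeight k t s l₀ l₁ b)) - referenceAnswer Ψ t s l₀ l₁ q =
      s / ((2 * v + 1) ^ 2) ^ m *
        ((1 / 2 + t) * (∑ x, q (Ψ (some x), 1) * ((-1) ^ hiddenSum b x *
          consecutiveMean^[k] (fun _ => 1) (hiddenSum b x))) +
        (1 / 2 - t) * (∑ x, q (Ψ (some x), -1) * ((-1) ^ hiddenSum b x *
          consecutiveMean^[k] (fun u => 1 - 2 * if -(k : ℤ) ≤ u ∧ u ≤ 2 * k then 1 else 0)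
            (hiddenSum b x)))) := by
  rw [integral_discreteLaw Ψ (hiddenWeight_nonneg ht0 ht hs h₀ h₁ b), Fintype.sum_option,
    referenceAnswer]
  simp only [hiddenWeight, if_true, show (-1 : ℤˣ) ≠ 1 by decide, if_false]
  rw [add_sub_add_left_eq_sub]
  simp only [Finset.mul_sum, ← Finset.sum_add_distrib, ← Finset.sum_sub_distrib]
  refine Finset.sum_congr rfl fun x _ => ?_
  rw [iterate_consecutiveMean_affine, labelWeight_one, labelWeight_neg_one, smoothWindow,
    iterate_consecutiveMean_eq (f := fun _ => (1 : ℝ)) (a := 1) k _ fun _ _ _ => rfl]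
  ring

/-- Few hidden distributions are distinguished from the reference by a given query. -/
lemma card_distinguished_le {X : Type} [MeasurableSpace X] [MeasurableSingletonClass X]
    (ht0 : 0 ≤ t) (ht : t ≤ 1 / 2) (hs : 0 ≤ s) (hs2 : s ≤ 2) (h₀ : 0 ≤ l₀) (h₁ : 0 ≤ l₁)
    (Ψ : Option (Fin m → Fin (2 * v + 1) × Fin (2 * v + 1)) → X)
    {q : X × ℤˣ → ℝ} (hq : ∀ z, |q z| ≤ 1) {τ : ℝ} (hτ : 0 < τ)
    (hv : 1 / (2 * v + 1 : ℝ) ^ k ≤ (τ / 4) ^ 2 / 2) :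
    (({b | τ < |∫ z, q z ∂(discreteLaw Ψ (hiddenWeight k t s l₀ l₁ b)) -
      referenceAnswer Ψ t s l₀ l₁ q|} : Set (Fin m → Bool)).ncard : ℝ) ≤
      8 * √(2 * (2 ^ k * 3 ^ m)) / τ := by
  set N : ℝ := ((2 * v + 1) ^ 2) ^ m with hN
  have hN0 : 0 < N := by positivity
  set F₁ : ℤ → ℝ := fun _ => 1
  set F₂ : ℤ → ℝ := fun u => 1 - 2 * if -(k : ℤ) ≤ u ∧ u ≤ 2 * k then 1 else 0
  have hone : ∀ (F : ℤ → ℝ), (∀ z, |F z| ≤ 1) →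
      ∀ (u : (Fin m → Fin (2 * v + 1) × Fin (2 * v + 1)) → ℝ), (∀ x, |u x| ≤ 1) →
      (({b | τ / 4 * N < |∑ x, u x * ((-1) ^ hiddenSum b x *
        consecutiveMean^[k] F (hiddenSum b x))|} : Set (Fin m → Bool)).ncard : ℝ) ≤
        4 * √(2 * (2 ^ k * 3 ^ m)) / τ := by
    intro F hF u hu
    have h := card_parity_correlation_le hF (by positivity) hv hu
    rw [← mul_pow] at h
    have := Real.le_sqrt_of_sq_le h
    rw [le_div_iff₀ hτ]
    linarith
  have h1 := hone F₁ (fun _ => by simp [F₁]) (fun x => q (Ψ (some x), 1)) fun _ => hq _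
  have h2 := hone F₂ (abs_one_sub_two_mul_indicator_le k) (fun x => q (Ψ (some x), -1))
    fun _ => hq _
  have hsub : ({b | τ < |∫ z, q z ∂(discreteLaw Ψ (hiddenWeight k t s l₀ l₁ b)) -
      referenceAnswer Ψ t s l₀ l₁ q|} : Set (Fin m → Bool)) ⊆
      {b | τ / 4 * N < |∑ x, q (Ψ (some x), 1) * ((-1) ^ hiddenSum b x *
        consecutiveMean^[k] F₁ (hiddenSum b x))|} ∪
      {b | τ / 4 * N < |∑ x, q (Ψ (some x), -1) * ((-1) ^ hiddenSum b x *
        consecutiveMean^[k] F₂ (hiddenSum b x))|} := by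
    intro b hb
    by_contra hcon
    simp only [Set.mem_union, Set.mem_ofPred_eq, not_or, not_lt] at hcon
    refine absurd (show τ < _ from hb) (not_lt.2 ?_)
    rw [integral_hidden_sub_reference ht0 ht hs h₀ h₁, abs_mul, abs_of_nonneg (by positivity)]
    -- The coefficients `1/2 + t` and `1/2 - t` sum to `1`, and `s ≤ 2` pays for the normalization.
    refine (mul_le_mul_of_nonneg_left (c := τ / 2 * N) ?_ (by positivity)).trans ?_
    · refine (abs_add_le _ _).trans ?_
      rw [abs_mul, abs_mul, abs_of_nonneg (by linarith : 0 ≤ 1 / 2 + t),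
        abs_of_nonneg (by linarith : 0 ≤ 1 / 2 - t)]
      have e1 := mul_le_mul_of_nonneg_left hcon.1 (by linarith : 0 ≤ 1 / 2 + t)
      have e2 := mul_le_mul_of_nonneg_left hcon.2 (by linarith : 0 ≤ 1 / 2 - t)
      have : 0 < τ * N := by positivity
      linarith
    · rw [div_mul_eq_mul_div, div_le_iff₀ hN0]
      nlinarith [mul_pos hτ hN0]
  have h3 := (Set.ncard_le_ncard hsub (Set.toFinite _)).trans (Set.ncard_union_le _ _)
  have h4 : (_ : ℝ) ≤ _ := Nat.cast_le.2 h3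
  refine h4.trans ?_
  push_cast
  calc _ ≤ _ := add_le_add h1 h2
    _ = _ := by ring

end hidden

/-- A windowed parity is nearly balanced. -/
lemma abs_sum_parity_le {m v k : ℕ} (hkm : k ≤ m) {F : ℤ → ℝ} (hF : ∀ z, |F z| ≤ 1)
    -- The proof correlates against the constant `1` with the complementary bit vector, which is at
    -- distance `m ≥ k`.
    (b : Fin m → Bool) :
    |∑ x : Fin m → Fin (2 * v + 1) × Fin (2 * v + 1),
      (-1 : ℝ) ^ hiddenSum b x * consecutiveMean^[k] F (hiddenSum b x)| ≤
      ((2 * v + 1) ^ 2) ^ m / (2 * v + 1) ^ k := by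
  have h := abs_correlation_le v m k b (fun i => !b i)
    (by simpa [bitDistance, Bool.eq_not] using hkm) F (fun _ => 1) hF (by simp) 0 0
  simpa using h

/-! ### Hardness for fixed parameters -/

set_option maxHeartbeats 1000000 in
/-- Hardness of learning for fixed values of the parameters of the hidden distributions. -/
theorem tsybakovHalfspaces_not_learnable {M m k v N : ℕ} {t ζ A α B τ τ' ε p : ℝ} {T : Set ℝ}
    (hk : 1 ≤ k) (hkm : k ≤ m) (hv1 : 1 ≤ v)
    (hM : Fintype.card (BoundedExponent (Fin m × Bool) (10 * k)) + 1 ≤ M)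
    (ht0 : 0 < t) (ht : t ≤ 1 / 6) (hζ0 : 0 < ζ) (hζ : ζ ≤ 1 / 8)
    (htail : ∀ b : Fin m → Bool,
      ((Finset.univ.filter fun x : Fin m → Fin (2 * v + 1) × Fin (2 * v + 1) =>
        (k : ℝ) < |(hiddenSum b x : ℝ)|).card : ℝ) ≤ ζ / 4 * ((2 * v + 1) ^ 2) ^ m)
    (hA : 0 < A) (hα0 : 0 ≤ α / (1 - α)) (hαB : α / (1 - α) ≤ B) (hsmall : 5 * ζ ≤ A * t ^ B)
    (hT : ∀ t ∈ T, 0 < t ∧ (t < 1 / 2 ∨ t = 1 / 2 ∧ (2 : ℝ) ^ (α / (1 - α)) ≤ A))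
    (hτ : 0 < τ) (hττ' : τ ≤ τ') (hv : 1 / (2 * v + 1 : ℝ) ^ k ≤ (τ / 4) ^ 2 / 2)
    (hε : 4 * t + 4 * ζ + τ ≤ 1 - 2 * ε)
    (hN : (N + 1) * (8 * √(2 * (2 ^ k * 3 ^ m)) / τ) < p * 2 ^ m) :
    ¬ ∃ R : RandomizedSQAlgorithm (EuclideanSpace ℝ (Fin M)),
      R.Learns (tsybakovHalfspaces M T A α ζ) N τ' ε p := by
  classical
  obtain ⟨Ψ, hΨ, hhalf⟩ := exists_halfspace_embedding (v := v) hk hM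
  choose w hw0 hwx using hhalf
  obtain ⟨n, hn⟩ : ∃ n : ℝ, n = ((2 * v + 1) ^ 2) ^ m := ⟨_, rfl⟩
  have hn0 : 0 < n := by rw [hn]; positivity
  have ht2 : t ≤ 1 / 2 := by linarith
  have hcard : (Fintype.card (Fin m → Fin (2 * v + 1) × Fin (2 * v + 1)) : ℝ) = n := by
    rw [hn]; simp [sq]
  let b₀ : Fin m → Bool := fun _ => true
  -- the total mass of the weights and the mass of the minority labels do not depend on the bits
  obtain ⟨e, he⟩ : ∃ e : ℝ, e = (∑ x : Fin m → Fin (2 * v + 1) × Fin (2 * v + 1),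
      (labelWeight k t (hiddenSum b₀ x) 1 + labelWeight k t (hiddenSum b₀ x) (-1))) / n := ⟨_, rfl⟩
  obtain ⟨o, ho⟩ : ∃ o : ℝ, o = (∑ x : Fin m → Fin (2 * v + 1) × Fin (2 * v + 1),
      labelWeight k t (hiddenSum b₀ x) (-majorityLabel k (hiddenSum b₀ x))) / n := ⟨_, rfl⟩
  have heb : ∀ b : Fin m → Bool, ∑ x : Fin m → Fin (2 * v + 1) × Fin (2 * v + 1),
      (labelWeight k t (hiddenSum b x) 1 + labelWeight k t (hiddenSum b x) (-1)) = e * n := by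
    intro b
    rw [he, div_mul_cancel₀ _ hn0.ne']
    exact sum_hiddenSum_eq b b₀ fun z => labelWeight k t z 1 + labelWeight k t z (-1)
  have hob : ∀ b : Fin m → Bool, ∑ x : Fin m → Fin (2 * v + 1) × Fin (2 * v + 1),
      labelWeight k t (hiddenSum b x) (-majorityLabel k (hiddenSum b x)) = o * n := by
    intro b
    rw [ho, div_mul_cancel₀ _ hn0.ne']
    exact sum_hiddenSum_eq b b₀ fun z => labelWeight k t z (-majorityLabel k z)
  have ho0 : 0 ≤ o := by
    rw [ho]
    exact div_nonneg (Finset.sum_nonneg fun x _ => (labelWeight_bounds ht0.le ht2 _ _).1) hn0.le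
  have ho1 : o ≤ ζ / 4 := by
    rw [ho, div_le_iff₀ hn0, hn]
    refine le_trans ?_ (htail b₀)
    rw [Finset.card_eq_sum_ones, Nat.cast_sum, Finset.sum_filter, Nat.cast_one]
    exact Finset.sum_le_sum fun x _ => labelWeight_minority_le ht0.le _
  -- The mean weight deviates from `1` only by windowed parity sums, each at most `n / 3` in
  -- absolute value.
  have he1 : 2 / 3 ≤ e := by
    have hsum : ∑ x : Fin m → Fin (2 * v + 1) × Fin (2 * v + 1),
        (labelWeight k t (hiddenSum b₀ x) 1 + labelWeight k t (hiddenSum b₀ x) (-1)) =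
        n + ((1 / 2 + t) * (∑ x : Fin m → Fin (2 * v + 1) × Fin (2 * v + 1),
            (-1) ^ hiddenSum b₀ x * consecutiveMean^[k] (fun _ => 1) (hiddenSum b₀ x)) +
          (1 / 2 - t) * (∑ x : Fin m → Fin (2 * v + 1) × Fin (2 * v + 1),
            (-1) ^ hiddenSum b₀ x * consecutiveMean^[k]
              (fun u => 1 - 2 * if -(k : ℤ) ≤ u ∧ u ≤ 2 * k then 1 else 0) (hiddenSum b₀ x))) := by
      have : n = ∑ _x : Fin m → Fin (2 * v + 1) × Fin (2 * v + 1), (1 : ℝ) := by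
        rw [← hcard]; simp
      rw [this]
      simp only [Finset.mul_sum, ← Finset.sum_add_distrib]
      refine Finset.sum_congr rfl fun x _ => ?_
      rw [iterate_consecutiveMean_affine, labelWeight_one, labelWeight_neg_one, smoothWindow,
        iterate_consecutiveMean_eq (f := fun _ => (1 : ℝ)) (a := 1) k _ fun _ _ _ => rfl]
      ring
    have h3 : n / (2 * v + 1) ^ k ≤ n / 3 := by
      refine div_le_div_of_nonneg_left hn0.le (by norm_num) ?_
      have hv1' : (1 : ℝ) ≤ v := by exact_mod_cast hv1
      calc (3 : ℝ) = 3 ^ 1 := by norm_num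
        _ ≤ 3 ^ k := pow_le_pow_right₀ (by norm_num) hk
        _ ≤ (2 * v + 1) ^ k := pow_le_pow_left₀ (by norm_num) (by linarith) k
    have h1 := abs_sum_parity_le (v := v) hkm (F := fun _ => 1) (by simp) b₀
    have h2 := abs_sum_parity_le (v := v) hkm (abs_one_sub_two_mul_indicator_le k) b₀
    rw [← hn] at h1 h2
    have h1' := (abs_le.1 (h1.trans h3)).1
    have h2' := (abs_le.1 (h2.trans h3)).1
    rw [he, le_div_iff₀ hn0, hsum]
    have e1 := mul_le_mul_of_nonneg_left h1' (by linarith : 0 ≤ 1 / 2 + t)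
    have e2 := mul_le_mul_of_nonneg_left h2' (by linarith : 0 ≤ 1 / 2 - t)
    linarith
  -- The cube receives total mass `1 - 4 * ζ` and the atom `4 * ζ`. The minority mass `l₀` of the
  -- atom fills the gap between the cube's error and `ζ`, making OPT exact.
  obtain ⟨s, hs⟩ : ∃ s : ℝ, s = (1 - 4 * ζ) / e := ⟨_, rfl⟩
  have hse : s * e = 1 - 4 * ζ := by rw [hs]; field_simp
  have hs0 : 0 ≤ s := by rw [hs]; exact div_nonneg (by linarith) (by linarith)
  have hs2 : s ≤ 2 := by rw [hs]; exact div_le_of_le_mul₀ (by linarith) (by norm_num) (by linarith)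
  have hso : s * o ≤ ζ / 2 := by nlinarith
  have hso0 : 0 ≤ s * o := mul_nonneg hs0 ho0
  obtain ⟨l₀, hl₀⟩ : ∃ l : ℝ, l = ζ - s * o := ⟨_, rfl⟩
  obtain ⟨l₁, hl₁⟩ : ∃ l : ℝ, l = 4 * ζ - l₀ := ⟨_, rfl⟩
  have h₀ : 0 ≤ l₀ := by linarith
  have h₁ : 0 ≤ l₁ := by linarith
  have hW := fun b : Fin m → Bool =>
    hiddenWeight_nonneg (v := v) (k := k) ht0.le ht2 hs0 h₀ h₁ b
  have hne : (-1 : ℤˣ) ≠ 1 := by decide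
  have hW1 : ∀ b : Fin m → Bool,
      ∑ ω : Option (Fin m → Fin (2 * v + 1) × Fin (2 * v + 1)),
        (hiddenWeight k t s l₀ l₁ b ω 1 + hiddenWeight k t s l₀ l₁ b ω (-1)) = 1 := by
    intro b
    rw [Fintype.sum_option]
    simp only [hiddenWeight, if_true, hne, if_false, ← mul_add, ← Finset.mul_sum]
    rw [heb, ← hn, hl₁]
    field_simp
    linarith
  have hD : ∀ b, discreteLaw Ψ (hiddenWeight k t s l₀ l₁ b) ∈ tsybakovHalfspaces M T A α ζ := by
    intro b
    refine discreteLaw_mem_tsybakovHalfspaces hΨ (hW b) (hW1 b) (w b) ht0 ht2 hA hα0 hαB ?_ ?_ ?_ hT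
    · rintro (_ | x)
      -- Here `l₀ ≤ ζ`, `l₁ ≥ 3 * ζ` and `t ≤ 1 / 6` keep the noise of the atom below `1/2 - t`.
      · rw [hw0]
        simp only [hiddenWeight, if_true, hne, if_false]
        nlinarith
      · rw [hwx]
        simp only [hiddenWeight]
        have h1 := labelWeight_minority_noise (k := k) ht0.le ht2 (hiddenSum b x)
        have h2 : 0 ≤ s / ((2 * v + 1) ^ 2 : ℝ) ^ m := by positivity
        have := mul_le_mul_of_nonneg_left h1 h2
        linarith
    · rw [Fintype.sum_option]
      simp only [hw0, hwx, hiddenWeight, hne, if_false, ← Finset.mul_sum]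
      rw [hob, ← hn, hl₀]
      field_simp
      ring
    · refine le_trans ?_ hsmall
      rw [Fintype.sum_option]
      simp only [hw0, hwx]
      have h1 : (if hiddenWeight (v := v) k t s l₀ l₁ b none (-1) = 0 then 0 else
          hiddenWeight (v := v) k t s l₀ l₁ b none 1 +
            hiddenWeight (v := v) k t s l₀ l₁ b none (-1)) ≤ 4 * ζ := by
        split_ifs
        · linarith
        · simp only [hiddenWeight, if_true, hne, if_false]
          linarith
      have h2 : ∑ x : Fin m → Fin (2 * v + 1) × Fin (2 * v + 1),
          (if hiddenWeight k t s l₀ l₁ b (some x) (-majorityLabel k (hiddenSum b x)) = 0 then 0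
            else hiddenWeight k t s l₀ l₁ b (some x) 1 +
              hiddenWeight k t s l₀ l₁ b (some x) (-1)) ≤
          ∑ x : Fin m → Fin (2 * v + 1) × Fin (2 * v + 1),
            4 / n * (if (k : ℝ) < |(hiddenSum b x : ℝ)| then 1 else 0) := by
        refine Finset.sum_le_sum fun x _ => ?_
        have h3 := labelWeight_minority_le (k := k) ht0.le (hiddenSum b x)
        have h4 := labelWeight_bounds (k := k) ht0.le ht2 (hiddenSum b x)
          (-majorityLabel k (hiddenSum b x))
        by_cases hx : (k : ℝ) < |(hiddenSum b x : ℝ)|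
        · rw [if_pos hx]
          split_ifs
          · positivity
          · simp only [hiddenWeight, ← hn, ← mul_add]
            rw [mul_one, div_mul_eq_mul_div]
            refine div_le_div_of_nonneg_right ?_ hn0.le
            nlinarith [h4.2]
        · rw [if_neg hx] at h3 ⊢
          rw [if_pos (by simp only [hiddenWeight]; rw [le_antisymm h3 h4.1, mul_zero]), mul_zero]
      rw [← Finset.mul_sum, ← Finset.sum_filter] at h2
      have h5 := htail b
      rw [← hn, Finset.card_eq_sum_ones, Nat.cast_sum, Nat.cast_one] at h5
      have h6 : 4 / n * ∑ x : Fin m → Fin (2 * v + 1) × Fin (2 * v + 1) with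
          (k : ℝ) < |(hiddenSum b x : ℝ)|, (1 : ℝ) ≤ ζ := by
        rw [div_mul_eq_mul_div, div_le_iff₀ hn0]
        linarith
      linarith
  have hq : ∀ q : EuclideanSpace ℝ (Fin M) × ℤˣ → ℝ, (∀ z, |q z| ≤ 1) → _ := fun q hq =>
    card_distinguished_le (m := m) ht0.le ht2 hs0 hs2 h₀ h₁ Ψ hq hτ hv
  refine not_learns_of_card_le _ (fun b => discreteLaw Ψ (hiddenWeight k t s l₀ l₁ b)) hD
    (fun q => referenceAnswer Ψ t s l₀ l₁ q.toFun) hτ.le hττ' (fun q => hq q.toFun q.abs_le_one) ?_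
    (by simpa using hN)
  intro h
  -- Under the reference the label correlates with any hypothesis by at most `4 * ζ + 4 * t`, so an
  -- error below `ε` makes this query distinguish `b` from the reference.
  set q : EuclideanSpace ℝ (Fin M) × ℤˣ → ℝ := fun z => ((z.2 : ℤ) : ℝ) * ((h.toFun z.1 : ℤ) : ℝ)
    with hqdef
  have hq1 : ∀ z, |q z| ≤ 1 := by
    intro z
    simp only [hqdef]
    rcases Int.units_eq_one_or z.2 with h1 | h1 <;>
      rcases Int.units_eq_one_or (h.toFun z.1) with h2 | h2 <;> simp [h1, h2]
  refine le_trans (Nat.cast_le.2 (Set.ncard_le_ncard ?_ (Set.toFinite _))) (hq q hq1)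
  intro b hb
  have hb' : misclassificationError (discreteLaw Ψ (hiddenWeight k t s l₀ l₁ b)) h.toFun < ε := hb
  rw [misclassificationError_eq_correlation Ψ (hW b) (hW1 b) h.measurable] at hb'
  have href : referenceAnswer Ψ t s l₀ l₁ q ≤ 4 * ζ + 4 * t := by
    have h1 : ∀ x : EuclideanSpace ℝ (Fin M), q (x, -1) = - q (x, 1) := by
      intro x; simp [hqdef]
    rw [referenceAnswer, h1]
    have h2 := abs_le.1 (hq1 (Ψ none, 1))
    have h3 := mul_le_mul_of_nonneg_left h2.2 (by linarith : 0 ≤ l₁ - l₀)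
    have h4 : ∑ x, ((1 / 2 + t) * q (Ψ (some x), 1) + (1 / 2 - t) * q (Ψ (some x), -1)) ≤
        2 * t * n := by
      rw [← hcard, mul_comm (2 * t), ← nsmul_eq_mul, ← Finset.card_univ]
      refine Finset.sum_le_card_nsmul _ _ _ fun x _ => ?_
      rw [h1]
      have := mul_le_mul_of_nonneg_left (abs_le.1 (hq1 (Ψ (some x), 1))).2
        (by linarith : 0 ≤ 2 * t)
      linarith
    have h5 : s / n * (2 * t * n) ≤ 4 * t := by
      rw [show s / n * (2 * t * n) = s * (2 * t) by field_simp]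
      nlinarith
    have h6 := mul_le_mul_of_nonneg_left h4 (by positivity : 0 ≤ s / n)
    rw [← hn]
    refine (add_le_add (?_ : _ ≤ 4 * ζ) (h6.trans h5))
    linarith
  have h7 : τ < ∫ z, q z ∂(discreteLaw Ψ (hiddenWeight k t s l₀ l₁ b)) -
      referenceAnswer Ψ t s l₀ l₁ q := by linarith
  exact h7.trans_le (le_abs_self _)

/-! ### Choice of parameters -/

/-- A power of the feature base is polynomial in `J`, while the fraction of close pairs decays
exponentially in `J`. -/
lemma exists_block_length (K : ℕ) :
    ∃ J : ℕ, 1 ≤ J ∧ 2 * ((10 * (J + 1) ^ 10 : ℕ) : ℝ) ^ (8 * K) * (3 / 4) ^ J ≤ 1 / 4 := by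
  have h := (tendsto_pow_const_mul_const_pow_of_abs_lt_one (80 * K)
    (show |(3 / 4 : ℝ)| < 1 by rw [abs_of_pos] <;> norm_num)).comp (Filter.tendsto_add_atTop_nat 1)
  have h2 := h.const_mul (2 * (10 : ℝ) ^ (8 * K) * (4 / 3))
  rw [mul_zero] at h2
  obtain ⟨J, hJ, hJ1⟩ := ((h2.eventually_le_const (show (0 : ℝ) < 1 / 4 by norm_num)).and
    (Filter.eventually_ge_atTop 1)).exists
  refine ⟨J, hJ1, le_trans (le_of_eq ?_) hJ⟩
  simp only [Function.comp]
  push_cast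
  rw [mul_pow, ← pow_mul, show 10 * (8 * K) = 80 * K by ring, pow_succ (3 / 4 : ℝ) J]
  ring

/-- With `2 * J * k` variables, `(1 + 1 / J) ^ J ≤ 3` leaves a factor `9 ^ k`; passing from `9` to
`10` absorbs the extra coordinate. -/
lemma card_features_le {J k : ℕ} (hJ : 1 ≤ J) (hk : 1 ≤ k) :
    Fintype.card (BoundedExponent (Fin (J * k) × Bool) (10 * k)) + 1 ≤
      (10 * (J + 1) ^ 10) ^ k := by
  have hJ0 : (0 : ℝ) < J := by exact_mod_cast hJ
  have h := card_boundedExponent_le (Fin (J * k) × Bool) (10 * k) hJ0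
  have h1 : (1 + 1 / (J : ℝ)) ^ J ≤ 3 := by
    rw [add_comm]
    refine (pow_le_pow_left₀ (by positivity) (Real.add_one_le_exp (1 / (J : ℝ))) J).trans ?_
    rw [← Real.exp_nat_mul, mul_one_div_cancel hJ0.ne']
    exact (Real.exp_one_lt_d9.trans (by norm_num)).le
  have h2 : (1 + 1 / (J : ℝ)) ^ Fintype.card (Fin (J * k) × Bool) ≤ 9 ^ k := by
    rw [Fintype.card_prod, Fintype.card_fin, Fintype.card_bool, mul_assoc, pow_mul, mul_comm k 2,
      pow_mul]
    refine pow_le_pow_left₀ (by positivity) ?_ k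
    exact (pow_le_pow_left₀ (by positivity) h1 2).trans (by norm_num)
  have h3 : (Fintype.card (BoundedExponent (Fin (J * k) × Bool) (10 * k)) : ℝ) ≤
      (9 * (J + 1) ^ 10) ^ k := by
    refine h.trans ((mul_le_mul_of_nonneg_left h2 (by positivity)).trans (le_of_eq ?_))
    rw [mul_pow, ← pow_mul, mul_comm]
  have h4 : Fintype.card (BoundedExponent (Fin (J * k) × Bool) (10 * k)) ≤
      (9 * (J + 1) ^ 10) ^ k := by exact_mod_cast h3
  refine (Nat.add_le_add_right h4 1).trans (Nat.succ_le_of_lt (Nat.pow_lt_pow_left ?_ (by omega)))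
  have : 0 < (J + 1) ^ 10 := by positivity
  omega

lemma eventually_two_rpow_neg_le {δ e : ℝ} (hδ : 0 < δ) (he : 0 < e) :
    ∀ᶠ L : ℝ in Filter.atTop, (2 : ℝ) ^ (-(δ * L)) ≤ e := by
  have h : Filter.Tendsto (fun L : ℝ => (2 : ℝ) ^ (-(δ * L))) Filter.atTop (nhds 0) := by
    have h1 : Filter.Tendsto (fun L : ℝ => Real.exp (-(Real.log 2 * δ * L))) Filter.atTop
        (nhds 0) :=
      Real.tendsto_exp_neg_atTop_nhds_zero.comp
        (Filter.tendsto_id.const_mul_atTop (mul_pos (Real.log_pos one_lt_two) hδ))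
    refine h1.congr fun L => ?_
    rw [Real.rpow_def_of_pos two_pos]
    ring_nf
  exact h.eventually_le_const he

lemma eventually_rpow_le_mul {c : ℝ} (hc : c < 1) {δ : ℝ} (hδ : 0 < δ) :
    ∀ᶠ y : ℝ in Filter.atTop, y ^ c ≤ δ * y := by
  filter_upwards [(tendsto_rpow_neg_atTop (sub_pos.2 hc)).eventually_le_const hδ,
    Filter.eventually_gt_atTop 0] with y hy hy0
  calc y ^ c = y ^ (-(1 - c)) * y := by
        rw [← Real.rpow_add_one hy0.ne']
        ring_nf
    _ ≤ δ * y := mul_le_mul_of_nonneg_right hy hy0.le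

/-- The hidden sum is concentrated in the window. -/
lemma card_outside_window_le {J k v : ℕ} (hJ : 1 ≤ J) (hv : 1 ≤ v) {ζ : ℝ}
    (h : 2 * Real.exp (-(k / (2 * J * v ^ 2))) ≤ ζ / 4) (b : Fin (J * k) → Bool) :
    ((Finset.univ.filter fun x : Fin (J * k) → Fin (2 * v + 1) × Fin (2 * v + 1) =>
      (k : ℝ) < |(hiddenSum b x : ℝ)|).card : ℝ) ≤ ζ / 4 * ((2 * v + 1) ^ 2) ^ (J * k) := by
  have hJ0 : (0 : ℝ) < J := by exact_mod_cast hJ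
  have hv0 : (0 : ℝ) < v := by exact_mod_cast hv
  -- This `s` minimizes the Chernoff exponent `J * k * s ^ 2 * v ^ 2 / 2 - s * k`.
  have h1 := card_hiddenSum_large_le (v := v) b (s := 1 / (J * v ^ 2)) (by positivity) k
  refine h1.trans ?_
  have h2 : ((J * k : ℕ) : ℝ) * ((1 / (J * v ^ 2 : ℝ)) ^ 2 * v ^ 2 / 2) - 1 / (J * v ^ 2) * k =
      -(k / (2 * J * v ^ 2)) := by
    push_cast
    field_simp
    ring
  rw [h2]
  have h3 : (0 : ℝ) ≤ ((2 * v + 1 : ℝ) ^ 2) ^ (J * k) := by positivity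
  nlinarith [mul_le_mul_of_nonneg_right h h3]

lemma window_tail_le {J v M b L : ℝ} {k : ℕ} (hJ0 : 0 < J) (hv0 : 0 < v) (hM0 : 0 < M)
    (hβ : 0 < Real.log b) (hMb : M ≤ b ^ (k + 1))
    (htail : Real.log 8 + Real.log 2 * L ≤
      1 / (2 * J * v ^ 2) * (Real.log M / Real.log b - 1)) :
    2 * Real.exp (-(k / (2 * J * v ^ 2))) ≤ (2 : ℝ) ^ (-L) / 4 := by
  have h1 : Real.log M ≤ (k + 1) * Real.log b := by
    rw [← Nat.cast_succ, ← Real.log_pow]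
    exact Real.log_le_log hM0 hMb
  have h2 : Real.log M / Real.log b - 1 ≤ k := by
    rw [sub_le_iff_le_add, div_le_iff₀ hβ]
    exact h1
  have h3 := mul_le_mul_of_nonneg_left h2 (by positivity : 0 ≤ 1 / (2 * J * v ^ 2))
  have h4 : Real.exp (-(k / (2 * J * v ^ 2))) ≤ Real.exp (-(Real.log 8 + Real.log 2 * L)) := by
    refine Real.exp_le_exp.2 (neg_le_neg (htail.trans (h3.trans (le_of_eq ?_))))
    rw [one_div, ← div_eq_inv_mul]
  rw [neg_add, Real.exp_add, Real.exp_neg (Real.log 8), Real.exp_log (by norm_num)] at h4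
  rw [Real.rpow_def_of_pos two_pos, mul_neg]
  linarith

lemma window_correlation_le {v M b : ℝ} {k K : ℕ} (hM0 : 0 < M) (hMb : M ≤ b ^ (2 * k))
    (hk : 1 ≤ k) (hv : 32 * b ^ (4 * K) ≤ 2 * v + 1) :
    1 / (2 * v + 1) ^ k ≤ (1 / M ^ K / 4) ^ 2 / 2 := by
  have h1 : (1 / M ^ K / 4) ^ 2 / 2 = 1 / (32 * M ^ (2 * K)) := by
    field_simp
    ring
  have hb : 0 ≤ b ^ (4 * K) := by
    rw [show 4 * K = 2 * (2 * K) by ring, pow_mul]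
    positivity
  rw [h1]
  refine one_div_le_one_div_of_le (by positivity) ?_
  calc 32 * M ^ (2 * K) ≤ 32 ^ k * (b ^ (2 * k)) ^ (2 * K) :=
        mul_le_mul (le_self_pow₀ (by norm_num) (by omega)) (pow_le_pow_left₀ hM0.le hMb _)
          (by positivity) (by positivity)
    _ = (32 * b ^ (4 * K)) ^ k := by
        rw [mul_pow, ← pow_mul, ← pow_mul]
        ring_nf
    _ ≤ (2 * v + 1) ^ k := pow_le_pow_left₀ (by positivity) hv k

/-- The bound on the number of distinguished distributions in the choice of parameters. -/
lemma query_count_lt {J k K b M N : ℕ} {p : ℝ}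
    (hJ : 2 * (b : ℝ) ^ (8 * K) * (3 / 4) ^ J ≤ 1 / 4) (hb : 1 ≤ b) (hM : M ≤ b ^ (2 * k))
    (hM1 : 1 ≤ M) (hN : (N : ℝ) ≤ (M : ℝ) ^ K) (hp : 32 * (1 / 2 : ℝ) ^ k < p) :
    (N + 1) * (8 * √(2 * (2 ^ k * 3 ^ (J * k))) / (1 / (M : ℝ) ^ K)) < p * 2 ^ (J * k) := by
  have hb0 : (0 : ℝ) < b := by exact_mod_cast hb
  have hM0 : (1 : ℝ) ≤ (M : ℝ) ^ K := one_le_pow₀ (by exact_mod_cast hM1)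
  set P : ℝ := (b : ℝ) ^ (4 * K * k) with hP
  have hP0 : 0 < P := by positivity
  have hMP : (M : ℝ) ^ K * (M : ℝ) ^ K ≤ P := by
    have : (M : ℝ) ≤ (b : ℝ) ^ (2 * k) := by exact_mod_cast hM
    calc (M : ℝ) ^ K * (M : ℝ) ^ K = (M : ℝ) ^ (2 * K) := by ring
      _ ≤ ((b : ℝ) ^ (2 * k)) ^ (2 * K) := pow_le_pow_left₀ (by positivity) this _
      _ = P := by rw [hP, ← pow_mul]; ring_nf
  have hS : √(2 * (2 ^ k * 3 ^ (J * k))) ≤ 2 * (1 / 2) ^ k * 2 ^ (J * k) / P := by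
    rw [Real.sqrt_le_left (by positivity), div_pow, le_div_iff₀ (by positivity)]
    have h1 := pow_le_pow_left₀ (by positivity) hJ k
    have h2 : (2 * (b : ℝ) ^ (8 * K) * (3 / 4) ^ J) ^ k * 4 ^ (J * k) =
        2 ^ k * 3 ^ (J * k) * P ^ 2 := by
      rw [hP, mul_pow, mul_pow, ← pow_mul, ← pow_mul, ← pow_mul, div_pow]
      field_simp
      ring_nf
    have h3 : (2 * (1 / 2 : ℝ) ^ k * 2 ^ (J * k)) ^ 2 = 4 * ((1 / 4) ^ k * 4 ^ (J * k)) := by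
      rw [mul_pow, mul_pow, ← pow_mul, ← pow_mul, mul_comm k 2, mul_comm (J * k) 2, pow_mul,
        pow_mul]
      norm_num
      ring
    have h4 := mul_le_mul_of_nonneg_right h1 (by positivity : (0 : ℝ) ≤ 4 ^ (J * k))
    rw [h2] at h4
    rw [h3]
    have h5 : (0 : ℝ) ≤ (1 / 4) ^ k * 4 ^ (J * k) := by positivity
    linarith
  have hN1 : (N : ℝ) + 1 ≤ 2 * (M : ℝ) ^ K := by linarith
  calc (N + 1) * (8 * √(2 * (2 ^ k * 3 ^ (J * k))) / (1 / (M : ℝ) ^ K))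
      = (N + 1) * (M : ℝ) ^ K * 8 * √(2 * (2 ^ k * 3 ^ (J * k))) := by rw [div_div_eq_mul_div]; ring
    _ ≤ (2 * (M : ℝ) ^ K) * (M : ℝ) ^ K * 8 * (2 * (1 / 2) ^ k * 2 ^ (J * k) / P) := by gcongr
    _ = ((M : ℝ) ^ K * (M : ℝ) ^ K) / P * (32 * (1 / 2) ^ k) * 2 ^ (J * k) := by ring
    _ ≤ 1 * (32 * (1 / 2) ^ k) * 2 ^ (J * k) := by
        gcongr
        exact (div_le_one hP0).2 hMP
    _ < p * 2 ^ (J * k) := by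
        rw [one_mul]
        exact mul_lt_mul_of_pos_right hp (by positivity)

/-- The conditions on the dimension under which the hidden distributions are hard to learn. -/
lemma exists_dimension_bound {κ A c p : ℝ} (hκ : 0 < κ) (hA : 0 < A) (hc0 : 0 < c) (hc1 : c < 1)
    (hp : 0 < p) {a β : ℝ} (ha : 0 < a) (hβ : 0 < β) {b : ℕ} (hb : 1 < b) :
    ∃ M₀ : ℕ, ∀ M : ℕ, M₀ ≤ M → 1 ≤ Nat.log b M ∧ 32 * (1 / 2 : ℝ) ^ Nat.log b M < p ∧
      (2 : ℝ) ^ (-(1 * Real.log M ^ c)) ≤ 1 / 8 ∧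
      (2 : ℝ) ^ (-(κ / 4 * Real.log M ^ c)) ≤ 1 / 8 ∧
      (2 : ℝ) ^ (-(1 / 2 * Real.log M ^ c)) ≤ A / 5 ∧
      κ * Real.log 2 / 4 * Real.log M ^ c ≤ Real.log M ∧
      Real.log 8 + Real.log 2 * Real.log M ^ c ≤ a * (Real.log M / β - 1) := by
  have hL := (tendsto_rpow_atTop hc0).comp
    (Real.tendsto_log_atTop.comp tendsto_natCast_atTop_atTop)
  have hy : Filter.Tendsto (fun M : ℕ => Real.log M) Filter.atTop Filter.atTop :=
    Real.tendsto_log_atTop.comp tendsto_natCast_atTop_atTop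
  have hk : Filter.Tendsto (fun M : ℕ => Nat.log b M) Filter.atTop Filter.atTop := by
    refine Filter.tendsto_atTop.2 fun k => ?_
    filter_upwards [Filter.eventually_ge_atTop (b ^ k)] with M hM
    exact Nat.le_log_of_pow_le hb hM
  have hpow : ∀ᶠ k : ℕ in Filter.atTop, 32 * (1 / 2 : ℝ) ^ k < p := by
    have := (tendsto_pow_atTop_nhds_zero_of_lt_one (by norm_num : (0 : ℝ) ≤ 1 / 2)
      (by norm_num)).const_mul 32
    rw [mul_zero] at this
    exact this.eventually_lt_const hp
  have hl2 : 0 < Real.log 2 := Real.log_pos one_lt_two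
  have h6 := hy.eventually (eventually_rpow_le_mul hc1 (δ := 1 / (κ * Real.log 2 / 4))
    (by positivity))
  have h7 := hy.eventually (eventually_rpow_le_mul hc1 (δ := a / (2 * β) / Real.log 2)
    (by positivity))
  have h8 := hy.eventually (Filter.eventually_ge_atTop ((Real.log 8 + a) / (a / (2 * β))))
  have h3 := hL.eventually (eventually_two_rpow_neg_le one_pos (by norm_num : (0 : ℝ) < 1 / 8))
  have h4 := hL.eventually (eventually_two_rpow_neg_le (by positivity : 0 < κ / 4)
    (by norm_num : (0 : ℝ) < 1 / 8))
  have h5 := hL.eventually (eventually_two_rpow_neg_le one_half_pos (by positivity : 0 < A / 5))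
  refine Filter.eventually_atTop.1 ?_
  filter_upwards [hk.eventually (Filter.eventually_ge_atTop 1), hk.eventually hpow, h3, h4, h5,
    h6, h7, h8] with M h1 h2 h3 h4 h5 h6 h7 h8
  refine ⟨h1, h2, h3, h4, h5, ?_, ?_⟩
  · rw [one_div, ← div_eq_inv_mul, le_div_iff₀ (by positivity)] at h6
    linarith
  · rw [div_le_iff₀ (by positivity)] at h8
    rw [div_mul_eq_mul_div, le_div_iff₀ hl2] at h7
    have : a * (Real.log M / β - 1) = a / (2 * β) * Real.log M + Real.log M * (a / (2 * β)) - a := by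
      field_simp
      ring
    linarith

set_option maxHeartbeats 1000000 in
theorem mainTheorem5 (κ : ℝ) (hκ : 0 < κ) :
    ∃ C : ℝ, 0 < C ∧
      ∀ A c p : ℝ, 0 < A → 0 < c → c < 1 → 0 < p → ∀ K : ℕ,
        ∃ M₀ : ℕ, ∀ M : ℕ, M₀ ≤ M → ∀ α : ℝ, 0 ≤ α → α ≤ 1 - κ →
          ∀ (N : ℕ) (τ : ℝ), (N : ℝ) ≤ (M : ℝ) ^ K → 1 / (M : ℝ) ^ K ≤ τ →
            -- the literal range `0 < t ≤ 1/2`; at `t = 1/2` it forces `2 ^ (α / (1 - α)) ≤ A`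
            ((2 : ℝ) ^ (α / (1 - α)) ≤ A →
              ¬ ∃ R : RandomizedSQAlgorithm (EuclideanSpace ℝ (Fin M)),
                R.Learns
                  (tsybakovHalfspaces M (Set.Ioc 0 (1 / 2)) A α
                    ((2 : ℝ) ^ (-(Real.log M ^ c))))
                  N τ (1 / 2 - Real.exp (-(C * Real.log M ^ c))) p) ∧
            -- every `A > 0`, for the range `0 < t < 1/2`
            ¬ ∃ R : RandomizedSQAlgorithm (EuclideanSpace ℝ (Fin M)),
                R.Learns
                  (tsybakovHalfspaces M (Set.Ioo 0 (1 / 2)) A α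
                    ((2 : ℝ) ^ (-(Real.log M ^ c))))
                  N τ (1 / 2 - Real.exp (-(C * Real.log M ^ c))) p := by
  have hl2 : 0 < Real.log 2 := Real.log_pos one_lt_two
  -- With `L = (log M)^c`, this makes the advantage `exp (-(C * L))` equal to `r = 2 ^ (-(κ / 4 *
  -- L))`.
  refine ⟨κ * Real.log 2 / 4, by positivity, fun A c p hA hc0 hc1 hp K => ?_⟩
  -- Working with `K + 1` makes the internal accuracy at most `1 / M ≤ r` even when `K = 0`.
  obtain ⟨J, hJ1, hJ⟩ := exists_block_length (K + 1)
  obtain ⟨b, hbdef⟩ : ∃ b : ℕ, b = 10 * (J + 1) ^ 10 := ⟨_, rfl⟩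
  rw [← hbdef] at hJ
  have hb1 : 1 < b := by
    have : 0 < (J + 1) ^ 10 := by positivity
    omega
  obtain ⟨v, hv⟩ : ∃ v : ℕ, v = 16 * b ^ (4 * (K + 1)) := ⟨_, rfl⟩
  have hv1 : 1 ≤ v := by
    have : 0 < b ^ (4 * (K + 1)) := by positivity
    omega
  have hJ0 : (0 : ℝ) < J := by exact_mod_cast hJ1
  have hv0 : (0 : ℝ) < v := by exact_mod_cast hv1
  have hβ : 0 < Real.log b := Real.log_pos (by exact_mod_cast hb1)
  obtain ⟨M₀, hM₀⟩ := exists_dimension_bound hκ hA hc0 hc1 hp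
    (a := 1 / (2 * J * v ^ 2)) (by positivity) hβ hb1
  refine ⟨M₀ + 1, fun M hM α hα0 hα1 N τ hN hτ => ?_⟩
  obtain ⟨hk1, hkp, hζ, ht, hAt, hCL, htail⟩ := hM₀ M (by omega)
  obtain ⟨k, hk⟩ : ∃ k, k = Nat.log b M := ⟨_, rfl⟩
  obtain ⟨L, hL⟩ : ∃ L, L = Real.log M ^ c := ⟨_, rfl⟩
  rw [← hk] at hk1 hkp
  rw [← hL] at hζ ht hAt hCL htail ⊢
  rw [one_mul] at hζ
  have hM1 : 1 ≤ M := by omega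
  have hM0 : (0 : ℝ) < M := by exact_mod_cast hM1
  have hbM : b ^ k ≤ M := by rw [hk]; exact Nat.pow_log_le_self b (by omega)
  have hMb : M < b ^ (k + 1) := by rw [hk]; exact Nat.lt_pow_succ_log_self hb1 M
  have hMb2 : M ≤ b ^ (2 * k) := hMb.le.trans (Nat.pow_le_pow_right (by omega) (by omega))
  have hκ1 : κ ≤ 1 := by linarith
  have hαd : 0 < 1 - α := by linarith
  have hα2 : 0 ≤ α / (1 - α) := div_nonneg hα0 hαd.le
  have hα3 : α / (1 - α) ≤ 1 / κ := div_le_div₀ zero_le_one (by linarith) hκ (by linarith)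
  set r : ℝ := (2 : ℝ) ^ (-(κ / 4 * L)) with hr
  have hr0 : 0 < r := by positivity
  have hexp : Real.exp (-(κ * Real.log 2 / 4 * L)) = r := by
    rw [hr, Real.rpow_def_of_pos two_pos]
    ring_nf
  have hrr : (2 : ℝ) ^ (-(κ / 2 * L)) = r * r := by
    rw [hr, ← Real.rpow_add two_pos]
    ring_nf
  have hL0 : 0 ≤ L := by
    rw [hL]
    exact Real.rpow_nonneg (Real.log_nonneg (by exact_mod_cast hM1)) c
  have hζr : (2 : ℝ) ^ (-L) ≤ r * r := by
    rw [← hrr]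
    refine Real.rpow_le_rpow_of_exponent_le one_le_two ?_
    nlinarith
  have hτr : 1 / (M : ℝ) ^ (K + 1) ≤ r := by
    have h1 : 1 / (M : ℝ) ≤ r := by
      have h2 := Real.exp_le_exp.2 (neg_le_neg hCL)
      rwa [hexp, Real.exp_neg, Real.exp_log hM0, ← one_div] at h2
    refine le_trans (one_div_le_one_div_of_le hM0 ?_) h1
    exact le_self_pow₀ (by exact_mod_cast hM1) (by omega)
  have hpowK : (M : ℝ) ^ K ≤ (M : ℝ) ^ (K + 1) :=
    pow_le_pow_right₀ (by exact_mod_cast hM1) (by omega)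
  have hτ' : 1 / (M : ℝ) ^ (K + 1) ≤ τ :=
    (one_div_le_one_div_of_le (by positivity) hpowK).trans hτ
  -- The right power equals `2 ^ (-L / 2)`, so half of the exponent of `ζ` is left over to absorb `5
  -- / A`.
  have hsmall : 5 * (2 : ℝ) ^ (-L) ≤ A * (r * r) ^ (1 / κ) := by
    have h1 : (r * r) ^ (1 / κ) = (2 : ℝ) ^ (-(1 / 2 * L)) := by
      rw [← hrr, ← Real.rpow_mul two_pos.le]
      congr 1
      field_simp
    have h2 : (2 : ℝ) ^ (-L) = (2 : ℝ) ^ (-(1 / 2 * L)) * (2 : ℝ) ^ (-(1 / 2 * L)) := by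
      rw [← Real.rpow_add two_pos]
      ring_nf
    rw [h1, h2]
    have h3 := mul_le_mul_of_nonneg_left hAt (by positivity : 0 ≤ (2 : ℝ) ^ (-(1 / 2 * L)))
    linarith
  have hwindow := window_tail_le hJ0 hv0 hM0 hβ (by exact_mod_cast hMb.le) htail
  have hνk : 1 / (2 * v + 1 : ℝ) ^ k ≤ (1 / (M : ℝ) ^ (K + 1) / 4) ^ 2 / 2 := by
    refine window_correlation_le (b := (b : ℝ)) hM0 (by exact_mod_cast hMb2) hk1 ?_
    rw [hv]
    push_cast
    linarith
  have hfeat : Fintype.card (BoundedExponent (Fin (J * k) × Bool) (10 * k)) + 1 ≤ M := by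
    refine (card_features_le hJ1 hk1).trans ?_
    rw [← hbdef]
    exact hbM
  have main : ∀ T : Set ℝ,
      (∀ t ∈ T, 0 < t ∧ (t < 1 / 2 ∨ t = 1 / 2 ∧ (2 : ℝ) ^ (α / (1 - α)) ≤ A)) →
      ¬ ∃ R : RandomizedSQAlgorithm (EuclideanSpace ℝ (Fin M)),
        R.Learns (tsybakovHalfspaces M T A α ((2 : ℝ) ^ (-L))) N τ
          (1 / 2 - Real.exp (-(κ * Real.log 2 / 4 * L))) p := by
    intro T hT
    rw [hexp]
    -- With `t = r ^ 2`, `ζ ≤ r ^ 2`, accuracy at most `r` and `r ≤ 1 / 8`, one has `4 * t + 4 * ζ +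
    -- τ ≤ 8 * r ^ 2 + r ≤ 2 * r`.
    refine tsybakovHalfspaces_not_learnable (m := J * k) (k := k) (v := v) (t := r * r) hk1
      (Nat.le_mul_of_pos_left k (by omega)) hv1 hfeat (by positivity) (by nlinarith)
      (by positivity) hζ (card_outside_window_le hJ1 hv1 hwindow) hA hα2 hα3 hsmall hT
      (τ := 1 / (M : ℝ) ^ (K + 1)) (by positivity) hτ' hνk (by nlinarith)
      (query_count_lt hJ hb1.le hMb2 hM1 (hN.trans hpowK) hkp)
  refine ⟨fun hA2 => main _ fun t ht => ⟨ht.1, ?_⟩, main _ fun t ht => ⟨ht.1, Or.inl ht.2⟩⟩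
  rcases ht.2.lt_or_eq with h | h
  · exact Or.inl h
  · exact Or.inr ⟨h, hA2⟩
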